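/- Let $\varphi_i(x) = A_i x + v_i$, $i \in \{1,\dots,N\}$, be affine maps of $\mathbb{R}^2$ with $A_i \in GL_2(\mathbb{R})$, $v_i \in \mathbb{R}^2$ and $\|A_i\| < 1$, and let $X \subset \mathbb{R}^2$ be the associated self-affine set, i.e. the non-empty compact set with $X = \bigcup_{i=1}^N \varphi_i(X)$. For a finite word $\mathtt{i} = i_1 \cdots i_n$ over $\{1,\dots,N\}$ (including the empty word) write $|\mathtt{i}| = n$, $A_{\mathtt{i}} = A_{i_1}\cdots A_{i_n}$ and $\varphi_{\mathtt{i}} = \varphi_{i_1}\circ\cdots\circ\varphi_{i_n}$ (the identity for the empty word). Let $\alpha_1(A) = \|A\|$ and $\alpha_2(A) = \|A^{-1}\|^{-1}$ be the singular values of $A \in GL_2(\mathbb{R})$. Let $$X_F = \Bigl\{ B\mathbb{R}^2 \in \mathbb{RP}^1 : B \in \overline{\{ c\, A_{i_1}^{-1}\cdots A_{i_n}^{-1} : c \in \mathbb{R},\ i_1 \cdots i_n \text{ a finite word} \}} \Bigr\}$$ be the set of Furstenberg directions, and for a line $V \in \mathbb{RP}^1$ let $\mathrm{proj}_{V^\perp}$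 be the orthogonal projection onto $V^\perp$. We say that $X$ * is *dominated* if there are $C > 0$ and $0 < \tau < 1$ such that $\alpha_2(A_{\mathtt{i}}) \le C \tau^{|\mathtt{i}|} \alpha_1(A_{\mathtt{i}})$ for all finite words $\mathtt{i}$; * satisfies the *strong separation condition* if $\varphi_i(X) \cap \varphi_j(X) = \emptyset$ whenever $i \ne j$; * satisfies the *projective open set condition* if there is $\eta > 0$ such that for all $V \in X_F$ and all finite words $\mathtt{i} \ne \mathtt{j}$ there is $x \in X$ with $$|\mathrm{proj}_{V^\perp}(\varphi_{\mathtt{i}}(x)) - \mathrm{proj}_{V^\perp}(\varphi_{\mathtt{j}}(x))| \ge \eta \,\mathrm{diam}\bigl(\mathrm{proj}_{V^\perp}(\varphi_{\mathtt{i}}(X))\bigr).$$ The Assouad dimension $\dim_A X$ is the infimum of all $s \ge 0$ for which there is a constant $C \ge 1$ such that for all $x \in X$ and $0 < r < R$ the set $X \cap B(x,R)$ can be covered by at most $C (R/r)^s$ closed balls of radius $r$ centred in $X$, where $B(x,R)$ is the closed ball. **Theorem.** If $X$ is dominated and satisfies the strong separation condition but not the projective open set condition, and if $X_F$ is not a singleton,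 then $\dim_A X \ge 1$. -/

import Mathlib

open scoped ENNReal NNReal LinearAlgebra.Projectivization

noncomputable section

/-- The Euclidean plane. -/
abbrev Plane : Type := EuclideanSpace ℝ (Fin 2)

/-- A number `s` is an admissible exponent for the Assouad dimension of `X` if there is a constant
`C ≥ 1` such that for all `x ∈ X` and `0 < r < R` the set `X ∩ B(x, R)` can be covered by at most
`C (R / r) ^ s` closed balls of radius `r` centred in `X`. -/
def IsAssouadExponent {α : Type*} [PseudoMetricSpace α] (X : Set α) (s : ℝ≥0) : Prop :=
  ∃ C : ℝ, 1 ≤ C ∧ ∀ x ∈ X, ∀ r R : ℝ, 0 < r → r < R →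
    ∃ t : Finset α, (t : Set α) ⊆ X ∧ (t.card : ℝ) ≤ C * (R / r) ^ (s : ℝ) ∧
      X ∩ Metric.closedBall x R ⊆ ⋃ y ∈ t, Metric.closedBall y r

/-- The Assouad dimension: the infimum of the admissible exponents (`∞` if there is none). -/
def assouadDim {α : Type*} [PseudoMetricSpace α] (X : Set α) : ℝ≥0∞ :=
  ⨅ (s : ℝ≥0) (_ : IsAssouadExponent X s), (s : ℝ≥0∞)

/-- The larger singular value of an invertible linear map of the plane. -/
def singularMax (A : Plane ≃L[ℝ] Plane) : ℝ := ‖(A : Plane →L[ℝ] Plane)‖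

/-- The smaller singular value of an invertible linear map of the plane. -/
def singularMin (A : Plane ≃L[ℝ] Plane) : ℝ := ‖(A.symm : Plane →L[ℝ] Plane)‖⁻¹

/-- An affine iterated function system on the plane: finitely many contractive invertible affine
maps `x ↦ A i x + v i`. -/
structure PlanarAffineIFS (N : ℕ) where
  /-- The linear parts. -/
  A : Fin N → (Plane ≃L[ℝ] Plane)
  /-- The translation vectors. -/
  v : Fin N → Plane
  /-- The linear parts are contractive. -/
  norm_lt_one : ∀ i, ‖(A i : Plane →L[ℝ] Plane)‖ < 1

namespace PlanarAffineIFS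

variable {N : ℕ} (F : PlanarAffineIFS N)

/-- The affine map with index `i`. -/
def map (i : Fin N) (x : Plane) : Plane := F.A i x + F.v i

/-- The composition `φ_{i₁} ∘ ⋯ ∘ φ_{iₙ}` along a finite word; the identity for the empty word. -/
def wordMap : List (Fin N) → Plane → Plane
  | [] => id
  | i :: w => F.map i ∘ wordMap w

/-- The product `A_{i₁} ⋯ A_{iₙ}` along a finite word; the identity for the empty word. -/
def wordLinear (w : List (Fin N)) : Plane ≃L[ℝ] Plane := (w.map F.A).prod

/-- `X` is the self-affine set of the system: the non-empty compact set that is the union of its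
images (it exists and is unique when `N ≥ 1`). -/
def IsSelfAffineSet (X : Set Plane) : Prop :=
  X.Nonempty ∧ IsCompact X ∧ X = ⋃ i, F.map i '' X

/-- Strong separation condition: the first level pieces of `X` are pairwise disjoint. -/
def StrongSeparation (X : Set Plane) : Prop :=
  Pairwise fun i j => Disjoint (F.map i '' X) (F.map j '' X)

/-- Domination: the ratio of the singular values of `A_{i₁} ⋯ A_{iₙ}` decays exponentially,
uniformly over all words. -/
def IsDominated : Prop :=
  ∃ C τ : ℝ, 0 < C ∧ 0 < τ ∧ τ < 1 ∧ ∀ w : List (Fin N),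
    singularMin (F.wordLinear w) ≤ C * τ ^ w.length * singularMax (F.wordLinear w)

/-- The set `X_F` of Furstenberg directions: the lines through the origin that are the image of
some linear map in the closure of the set of all multiples of the products
`A_{i₁}⁻¹ ⋯ A_{iₙ}⁻¹ = (A_{iₙ} ⋯ A_{i₁})⁻¹`. -/
def furstenbergDirections : Set (ℙ ℝ Plane) :=
  {V | ∃ B ∈ closure {B : Plane →L[ℝ] Plane | ∃ (c : ℝ) (w : List (Fin N)),
      B = c • (((F.wordLinear w.reverse)⁻¹ : Plane ≃L[ℝ] Plane) : Plane →L[ℝ] Plane)},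
    LinearMap.range (B : Plane →ₗ[ℝ] Plane) = V.submodule}

/-- The orthogonal projection of the plane onto the orthogonal complement of the line `V`. -/
def projPerp (V : ℙ ℝ Plane) : Plane →L[ℝ] Plane := V.submoduleᗮ.starProjection

/-- Projective open set condition for the self-affine set `X`. -/
def ProjectiveOpenSetCondition (X : Set Plane) : Prop :=
  ∃ η : ℝ, 0 < η ∧ ∀ V ∈ F.furstenbergDirections, ∀ i j : List (Fin N), i ≠ j →
    ∃ x ∈ X, η * Metric.diam (projPerp V '' (F.wordMap i '' X)) ≤
      ‖projPerp V (F.wordMap i x) - projPerp V (F.wordMap j x)‖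

end PlanarAffineIFS

end

/-! Transversally to Furstenberg directions, `X` contains arbitrarily long chains of points with
comparable gaps. A long cylinder maps such a chain into `X` so that the component along its strongly
contracted direction becomes negligible. The image is a nearly arithmetic progression, and long
progressions force Assouad dimension at least one (`one_le_assouadDim`).

Domination enters through `exists_le_opNorm_mul`: operator norms of word products are multiplicative
up to one constant. Passing to rank one limits of inverse products shows that inverse words expand
Furstenberg vectors at the full rate of their norm (`IsDominated.exists_le_norm_symm_apply`). Hence
transversal widths of cylinders are almost multiplicative, and one word can steer all Furstenberg
directions close to a given one (`IsDominated.exists_smul_symm_mem`). In particular no Furstenberg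
direction is isolated when there are at least two.

If the projective open set condition fails, two different words act, in some Furstenberg direction,
almost identically relative to the width. Strong separation makes the maps differ, so a small change
of direction makes the displacement nonzero. On a subcylinder of bounded depth it has constant sign
and comparable values (`exists_displaces_at`). Steering makes the word pair work for all Furstenberg
directions. A common suffix shrinks the width while keeping the displacement comparable, so every
relative size is available (`exists_displaces`). Choosing that size to match the gaps of a chain
lengthens the chain by one point (`exists_chain`). -/

open scoped Topology

noncomputable section

/-! ### The area form and operator norms in the plane -/

/-- The standard area form on the plane. -/
def area (x y : Plane) : ℝ := x 0 * y 1 - x 1 * y 0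

/-- Rotation of the plane by a right angle. -/
def quarterTurn (x : Plane) : Plane := !₂[-x 1, x 0]

/-- The determinant of an invertible linear map of the plane. -/
def planeDet (A : Plane ≃L[ℝ] Plane) : ℝ := area (A !₂[1, 0]) (A !₂[0, 1])

theorem area_add_left (x y z : Plane) : area (x + y) z = area x z + area y z := by
  simp [area]; ring

theorem area_add_right (x y z : Plane) : area x (y + z) = area x y + area x z := by
  simp [area]; ring

theorem area_sub_left (x y z : Plane) : area (x - y) z = area x z - area y z := by
  simp [area]; ring

theorem area_sub_right (x y z : Plane) : area x (y - z) = area x y - area x z := by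
  simp [area]; ring

theorem area_smul_left (c : ℝ) (x y : Plane) : area (c • x) y = c * area x y := by
  simp [area]; ring

theorem area_smul_right (c : ℝ) (x y : Plane) : area x (c • y) = c * area x y := by
  simp [area]; ring

theorem area_self (x : Plane) : area x x = 0 := by
  simp [area]; ring

theorem area_comm (x y : Plane) : area x y = -area y x := by
  simp [area]; ring

theorem plane_norm_sq (x : Plane) : ‖x‖ ^ 2 = x 0 ^ 2 + x 1 ^ 2 := by
  simp [EuclideanSpace.norm_sq_eq, Fin.sum_univ_two]

theorem plane_inner (x y : Plane) : inner ℝ x y = x 0 * y 0 + x 1 * y 1 := by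
  simp [PiLp.inner_apply, Fin.sum_univ_two]; ring

theorem area_sq_add_inner_sq (x y : Plane) :
    area x y ^ 2 + (inner ℝ x y : ℝ) ^ 2 = ‖x‖ ^ 2 * ‖y‖ ^ 2 := by
  rw [plane_norm_sq, plane_norm_sq, plane_inner, area]; ring

theorem abs_area_le (x y : Plane) : |area x y| ≤ ‖x‖ * ‖y‖ := by
  apply abs_le_of_sq_le_sq _ (by positivity)
  have := area_sq_add_inner_sq x y
  nlinarith [sq_nonneg (inner ℝ x y : ℝ)]

theorem norm_quarterTurn (x : Plane) : ‖quarterTurn x‖ = ‖x‖ := by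
  rw [← sq_eq_sq₀ (norm_nonneg _) (norm_nonneg _), plane_norm_sq, plane_norm_sq]
  simp [quarterTurn]; ring

theorem area_quarterTurn (x y : Plane) : area x (quarterTurn y) = inner ℝ x y := by
  rw [plane_inner]; simp [area, quarterTurn]

/-- Orthogonal decomposition of `x` along `y`. -/
theorem norm_sq_smul_eq (x y : Plane) :
    ‖y‖ ^ 2 • x = (inner ℝ y x : ℝ) • y + area y x • quarterTurn y := by
  rw [plane_norm_sq, plane_inner]
  ext i
  fin_cases i <;> simp [area, quarterTurn] <;> ring

/-- Triangle inequality for sines of angles: decompose `x` along the unit vector `y` and its quarter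
turn, with all remaining coefficients at most one. -/
theorem area_sub_triangle (x y z : Plane) (hx : ‖x‖ ≤ 1) (hy : ‖y‖ = 1) (hz : ‖z‖ ≤ 1) :
    |area x z| ≤ |area x y| + |area y z| := by
  have h := norm_sq_smul_eq x y
  rw [hy, one_pow, one_smul] at h
  have h1 : area x z = (inner ℝ y x : ℝ) * area y z + area y x * area (quarterTurn y) z := by
    conv_lhs => rw [h]
    rw [area_add_left, area_smul_left, area_smul_left]
  have h2 : |(inner ℝ y x : ℝ)| ≤ 1 := by
    have := abs_real_inner_le_norm y x
    rw [hy] at this; linarith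
  have h3 : |area (quarterTurn y) z| ≤ 1 := by
    have := abs_area_le (quarterTurn y) z
    rw [norm_quarterTurn, hy] at this; linarith
  rw [h1]
  refine (abs_add_le _ _).trans ?_
  rw [abs_mul, abs_mul, area_comm y x, abs_neg]
  nlinarith [abs_nonneg (area y z), abs_nonneg (area x y)]

theorem plane_eq (x : Plane) : x = x 0 • !₂[1, 0] + x 1 • !₂[0, 1] := by
  ext i
  fin_cases i <;> simp

theorem area_map (A : Plane ≃L[ℝ] Plane) (x y : Plane) :
    area (A x) (A y) = planeDet A * area x y := by
  have hx : A x = x 0 • A !₂[1, 0] + x 1 • A !₂[0, 1] := by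
    conv_lhs => rw [plane_eq x]
    simp
  have hy : A y = y 0 • A !₂[1, 0] + y 1 • A !₂[0, 1] := by
    conv_lhs => rw [plane_eq y]
    simp
  rw [hx, hy, planeDet]
  simp [area]; ring

theorem planeDet_mul (A B : Plane ≃L[ℝ] Plane) :
    planeDet (A * B) = planeDet A * planeDet B := by
  unfold planeDet
  exact area_map A (B _) (B _)

theorem planeDet_ne_zero (A : Plane ≃L[ℝ] Plane) : planeDet A ≠ 0 := by
  intro h
  have := area_map A (A.symm !₂[1, 0]) (A.symm !₂[0, 1])
  rw [h] at this
  simp [area] at this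

theorem area_apply_right (A : Plane ≃L[ℝ] Plane) (x y : Plane) :
    area x (A y) = planeDet A * area (A.symm x) y := by
  rw [← area_map, A.apply_symm_apply]

/-- The norm of a linear functional given by the area form. -/
theorem norm_eq_of_abs_area_le {x : Plane} {c : ℝ} (hc : 0 ≤ c)
    (h : ∀ y, ‖y‖ ≤ 1 → |area y x| ≤ c) : ‖x‖ ≤ c := by
  rcases eq_or_ne x 0 with rfl | hx
  · simpa
  have h1 := h (‖x‖⁻¹ • quarterTurn x) (by
    rw [norm_smul, norm_quarterTurn, norm_inv, norm_norm, inv_mul_cancel₀ (norm_ne_zero_iff.2 hx)])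
  rw [area_smul_left, area_comm, area_quarterTurn, real_inner_self_eq_norm_sq, abs_mul, abs_neg,
    abs_of_nonneg (by positivity), abs_of_nonneg (by positivity)] at h1
  have : 0 < ‖x‖ := norm_pos_iff.2 hx
  have h2 : ‖x‖⁻¹ * ‖x‖ ^ 2 = ‖x‖ := by field_simp
  linarith

/-- Up to the determinant, the inverse is the adjoint for the area form, and adjoints have equal
norm. This moves norm estimates between words and their inverses. -/
theorem opNorm_eq_abs_planeDet_mul (A : Plane ≃L[ℝ] Plane) :
    ‖(A : Plane →L[ℝ] Plane)‖ = |planeDet A| * ‖(A.symm : Plane →L[ℝ] Plane)‖ := by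
  have key : ∀ B : Plane ≃L[ℝ] Plane,
      ‖(B : Plane →L[ℝ] Plane)‖ ≤ |planeDet B| * ‖(B.symm : Plane →L[ℝ] Plane)‖ := by
    intro B
    refine ContinuousLinearMap.opNorm_le_bound _ (by positivity) fun x => ?_
    refine norm_eq_of_abs_area_le (by positivity) fun y hy => ?_
    change |area y (B x)| ≤ _
    rw [area_apply_right, abs_mul]
    have h1 := abs_area_le (B.symm y) x
    have h2 := (B.symm : Plane →L[ℝ] Plane).le_opNorm y
    have h3 : ‖B.symm y‖ ≤ ‖(B.symm : Plane →L[ℝ] Plane)‖ :=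
      h2.trans (mul_le_of_le_one_right (norm_nonneg _) hy)
    rw [mul_assoc]
    gcongr
    exact h1.trans (by gcongr)
  refine le_antisymm (key A) ?_
  have h1 := key A.symm
  have h2 : planeDet A * planeDet A.symm = 1 := by
    rw [← planeDet_mul]
    have : A * A.symm = 1 := mul_inv_cancel A
    rw [this]
    change area !₂[1, 0] !₂[0, 1] = 1
    simp [area]
  have h3 : |planeDet A| * |planeDet A.symm| = 1 := by rw [← abs_mul, h2, abs_one]
  rw [ContinuousLinearEquiv.symm_symm] at h1
  calc _ ≤ |planeDet A| * (|planeDet A.symm| * ‖(A : Plane →L[ℝ] Plane)‖) := by gcongr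
    _ = _ := by rw [← mul_assoc, h3, one_mul]

theorem opNorm_pos (A : Plane ≃L[ℝ] Plane) : 0 < ‖(A : Plane →L[ℝ] Plane)‖ := by
  rw [norm_pos_iff]
  intro h
  have : A !₂[1, 0] = 0 := by
    change (A : Plane →L[ℝ] Plane) _ = 0
    rw [h]; rfl
  rw [map_eq_zero_iff _ A.injective] at this
  have := congrArg (fun x : Plane => x 0) this
  simp at this

theorem le_opNorm_apply (A : Plane ≃L[ℝ] Plane) (x : Plane) :
    ‖A x‖ ≤ ‖(A : Plane →L[ℝ] Plane)‖ * ‖x‖ := (A : Plane →L[ℝ] Plane).le_opNorm x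

theorem opNorm_mul_le (A B : Plane ≃L[ℝ] Plane) :
    ‖((A * B : Plane ≃L[ℝ] Plane) : Plane →L[ℝ] Plane)‖ ≤
      ‖(A : Plane →L[ℝ] Plane)‖ * ‖(B : Plane →L[ℝ] Plane)‖ :=
  ContinuousLinearMap.opNorm_comp_le (A : Plane →L[ℝ] Plane) (B : Plane →L[ℝ] Plane)

/-- A norming vector. -/
theorem exists_unit_norm_apply_eq (A : Plane ≃L[ℝ] Plane) :
    ∃ x : Plane, ‖x‖ = 1 ∧ ‖A x‖ = ‖(A : Plane →L[ℝ] Plane)‖ := by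
  have hne : (Metric.sphere (0 : Plane) 1).Nonempty := NormedSpace.sphere_nonempty.2 zero_le_one
  obtain ⟨x, hx, hmax⟩ := (isCompact_sphere (0 : Plane) 1).exists_isMaxOn hne
    (f := fun x => ‖A x‖) (by fun_prop)
  rw [mem_sphere_zero_iff_norm] at hx
  refine ⟨x, hx, le_antisymm ?_ ?_⟩
  · simpa [hx] using le_opNorm_apply A x
  · refine ContinuousLinearMap.opNorm_le_of_unit_norm (norm_nonneg _) fun y hy => ?_
    exact hmax (mem_sphere_zero_iff_norm.2 hy)

/-- The direction that is contracted the most. -/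
theorem exists_unit_norm_apply_eq_inv (A : Plane ≃L[ℝ] Plane) :
    ∃ x : Plane, ‖x‖ = 1 ∧ ‖A x‖ = ‖(A.symm : Plane →L[ℝ] Plane)‖⁻¹ := by
  obtain ⟨y, hy, hA⟩ := exists_unit_norm_apply_eq A.symm
  have hpos := opNorm_pos A.symm
  refine ⟨‖A.symm y‖⁻¹ • A.symm y, ?_, ?_⟩
  · rw [norm_smul, norm_inv, norm_norm, inv_mul_cancel₀ (by rw [hA]; exact hpos.ne')]
  · rw [map_smul, A.apply_symm_apply, norm_smul, norm_inv, norm_norm, hA, hy, mul_one]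

/-! ### Singular value ratios and most contracted directions -/

/-- The ratio of the singular values. -/
def dilatation (A : Plane ≃L[ℝ] Plane) : ℝ :=
  ‖(A : Plane →L[ℝ] Plane)‖ * ‖(A.symm : Plane →L[ℝ] Plane)‖

theorem dilatation_pos (A : Plane ≃L[ℝ] Plane) : 0 < dilatation A :=
  mul_pos (opNorm_pos A) (opNorm_pos A.symm)

theorem dilatation_inv (A : Plane ≃L[ℝ] Plane) : dilatation A⁻¹ = dilatation A :=
  mul_comm _ _

theorem dilatation_mul_le (A B : Plane ≃L[ℝ] Plane) :
    dilatation (A * B) ≤ dilatation A * dilatation B := by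
  have h1 := opNorm_mul_le A B
  have h2 := opNorm_mul_le B.symm A.symm
  have h3 : (A * B).symm = B.symm * A.symm := rfl
  unfold dilatation
  rw [h3]
  calc _ ≤ (‖(A : Plane →L[ℝ] Plane)‖ * ‖(B : Plane →L[ℝ] Plane)‖) *
        (‖(B.symm : Plane →L[ℝ] Plane)‖ * ‖(A.symm : Plane →L[ℝ] Plane)‖) := by gcongr
    _ = _ := by ring

theorem dilatation_one : dilatation 1 = 1 := by
  have h1 : ‖((1 : Plane ≃L[ℝ] Plane) : Plane →L[ℝ] Plane)‖ = 1 :=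
    ContinuousLinearMap.norm_id (𝕜 := ℝ) (E := Plane)
  have h2 : ‖((1 : Plane ≃L[ℝ] Plane).symm : Plane →L[ℝ] Plane)‖ = 1 :=
    ContinuousLinearMap.norm_id (𝕜 := ℝ) (E := Plane)
  rw [dilatation, h1, h2, one_mul]

theorem opNorm_le_opNorm_mul (A B : Plane ≃L[ℝ] Plane) :
    ‖(B : Plane →L[ℝ] Plane)‖ ≤ ‖(A.symm : Plane →L[ℝ] Plane)‖ *
      ‖((A * B : Plane ≃L[ℝ] Plane) : Plane →L[ℝ] Plane)‖ := by
  have h := opNorm_mul_le A.symm (A * B)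
  have h2 : A.symm * (A * B) = B := inv_mul_cancel_left A B
  rwa [h2] at h

theorem opNorm_le_mul_opNorm (A B : Plane ≃L[ℝ] Plane) :
    ‖(A : Plane →L[ℝ] Plane)‖ ≤
      ‖((A * B : Plane ≃L[ℝ] Plane) : Plane →L[ℝ] Plane)‖ * ‖(B.symm : Plane →L[ℝ] Plane)‖ := by
  have h := opNorm_mul_le (A * B) B.symm
  have h2 : (A * B) * B.symm = A := mul_inv_cancel_right A B
  rwa [h2] at h

theorem opNorm_sq_eq (A : Plane ≃L[ℝ] Plane) :
    ‖(A : Plane →L[ℝ] Plane)‖ ^ 2 = |planeDet A| * dilatation A := by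
  rw [dilatation, sq]
  conv_lhs => rw [opNorm_eq_abs_planeDet_mul A]
  rw [opNorm_eq_abs_planeDet_mul A]
  ring

/-- `s` is a unit vector in the direction that `A` contracts the most. -/
def IsContracted (A : Plane ≃L[ℝ] Plane) (s : Plane) : Prop :=
  ‖s‖ = 1 ∧ ‖A s‖ = ‖(A.symm : Plane →L[ℝ] Plane)‖⁻¹

theorem exists_isContracted (A : Plane ≃L[ℝ] Plane) : ∃ s, IsContracted A s :=
  exists_unit_norm_apply_eq_inv A

theorem IsContracted.le_norm_apply {A : Plane ≃L[ℝ] Plane} {s : Plane} (h : IsContracted A s)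
    (v : Plane) : ‖(A : Plane →L[ℝ] Plane)‖ * |area s v| ≤ ‖A v‖ := by
  have h1 := abs_area_le (A s) (A v)
  rw [area_map, abs_mul, h.2] at h1
  rw [opNorm_eq_abs_planeDet_mul]
  have hp := opNorm_pos A.symm
  rw [inv_mul_eq_div, le_div_iff₀ hp] at h1
  linarith

/-- The vector `s` stays short under `A * B`, while `A * B` stretches vectors transversal to `s'`.
Thus a further factor on the left barely turns the contracted direction once `B` is very eccentric.
-/
theorem IsContracted.abs_area_le_div {A B : Plane ≃L[ℝ] Plane} {s s' : Plane}
    (h : IsContracted B s) (h' : IsContracted (A * B) s') :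
    |area s s'| ≤ dilatation A / dilatation B := by
  have h1 := h'.le_norm_apply s
  have h2 : ‖(A * B) s‖ ≤ ‖(A : Plane →L[ℝ] Plane)‖ * ‖(B.symm : Plane →L[ℝ] Plane)‖⁻¹ := by
    rw [← h.2]; exact le_opNorm_apply A (B s)
  have h3 := opNorm_le_opNorm_mul A B
  have hA := opNorm_pos A
  have hA' := opNorm_pos A.symm
  have hB := opNorm_pos B
  have hB' := opNorm_pos B.symm
  have hAB := opNorm_pos (A * B)
  rw [area_comm, abs_neg]
  rw [le_div_iff₀ (dilatation_pos B)]
  unfold dilatation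
  have h4 := h1.trans h2
  rw [← div_eq_mul_inv, le_div_iff₀ hB'] at h4
  calc |area s' s| * (‖(B : Plane →L[ℝ] Plane)‖ * ‖(B.symm : Plane →L[ℝ] Plane)‖)
      ≤ |area s' s| * ((‖(A.symm : Plane →L[ℝ] Plane)‖ *
      ‖((A * B : Plane ≃L[ℝ] Plane) : Plane →L[ℝ] Plane)‖) *
        ‖(B.symm : Plane →L[ℝ] Plane)‖) := by gcongr
    _ = ‖(A.symm : Plane →L[ℝ] Plane)‖ *
        (‖((A * B : Plane ≃L[ℝ] Plane) : Plane →L[ℝ] Plane)‖ * |area s' s| *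
          ‖(B.symm : Plane →L[ℝ] Plane)‖) := by ring
    _ ≤ ‖(A.symm : Plane →L[ℝ] Plane)‖ * ‖(A : Plane →L[ℝ] Plane)‖ := by gcongr
    _ = _ := mul_comm _ _

/-- Here `e` is the major axis of the image ellipse of `B`. Norm is lost in the product only when
this axis is nearly the direction contracted by `A`. -/
theorem le_opNorm_mul_of_isContracted {A B : Plane ≃L[ℝ] Plane} {s e : Plane}
    (hs : IsContracted A s) (he : IsContracted B⁻¹ e) :
    ‖(A : Plane →L[ℝ] Plane)‖ * ‖(B : Plane →L[ℝ] Plane)‖ * |area s e| ≤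
      ‖((A * B : Plane ≃L[ℝ] Plane) : Plane →L[ℝ] Plane)‖ := by
  have h1 := hs.le_norm_apply e
  have h2 := le_opNorm_apply (A * B) (B.symm e)
  have h3 : (A * B) (B.symm e) = A e := congrArg A (B.apply_symm_apply e)
  have h4 : ‖B.symm e‖ = ‖(B : Plane →L[ℝ] Plane)‖⁻¹ := he.2
  have hB := opNorm_pos B
  rw [h3, h4, ← div_eq_mul_inv, le_div_iff₀ hB] at h2
  calc _ = ‖(A : Plane →L[ℝ] Plane)‖ * |area s e| * ‖(B : Plane →L[ℝ] Plane)‖ := by ring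
    _ ≤ ‖A e‖ * ‖(B : Plane →L[ℝ] Plane)‖ := by gcongr
    _ ≤ _ := h2

theorem opNorm_mul_le_of_isContracted {A B : Plane ≃L[ℝ] Plane} {s e : Plane}
    (hs : IsContracted A s) (he : IsContracted B⁻¹ e) :
    ‖((A * B : Plane ≃L[ℝ] Plane) : Plane →L[ℝ] Plane)‖ ≤
      ‖(A : Plane →L[ℝ] Plane)‖ * ‖(B : Plane →L[ℝ] Plane)‖ *
        (|area s e| + (dilatation A)⁻¹ + (dilatation B)⁻¹) := by
  have hA := opNorm_pos A
  have hA' := opNorm_pos A.symm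
  have hB := opNorm_pos B
  have hB' := opNorm_pos B.symm
  refine ContinuousLinearMap.opNorm_le_bound _
    (by have := dilatation_pos A; have := dilatation_pos B; positivity) fun x => ?_
  change ‖A (B x)‖ ≤ _
  have hdec := norm_sq_smul_eq (B x) e
  rw [he.1, one_pow, one_smul] at hdec
  have hin : |(inner ℝ e (B x) : ℝ)| ≤ ‖(B : Plane →L[ℝ] Plane)‖ * ‖x‖ := by
    have := abs_real_inner_le_norm e (B x)
    rw [he.1, one_mul] at this
    exact this.trans (le_opNorm_apply B x)
  have har : |area e (B x)| ≤ ‖(B.symm : Plane →L[ℝ] Plane)‖⁻¹ * ‖x‖ := by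
    rw [area_apply_right, abs_mul]
    have h1 := abs_area_le (B.symm e) x
    have h4 : ‖B.symm e‖ = ‖(B : Plane →L[ℝ] Plane)‖⁻¹ := he.2
    rw [h4] at h1
    have h5 := opNorm_eq_abs_planeDet_mul B
    have h6 : ‖(B.symm : Plane →L[ℝ] Plane)‖⁻¹ =
        |planeDet B| * ‖(B : Plane →L[ℝ] Plane)‖⁻¹ := by
      have : |planeDet B| ≠ 0 := abs_ne_zero.2 (planeDet_ne_zero B)
      rw [h5]; field_simp
    rw [h6, mul_assoc]
    gcongr
  have hAe : ‖A e‖ ≤ ‖(A.symm : Plane →L[ℝ] Plane)‖⁻¹ +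
      ‖(A : Plane →L[ℝ] Plane)‖ * |area s e| := by
    have hdec := norm_sq_smul_eq e s
    rw [hs.1, one_pow, one_smul] at hdec
    conv_lhs => rw [hdec]
    rw [map_add, map_smul, map_smul]
    refine (norm_add_le _ _).trans ?_
    rw [norm_smul, norm_smul, hs.2, Real.norm_eq_abs, Real.norm_eq_abs]
    have h1 := abs_real_inner_le_norm s e
    rw [hs.1, he.1, one_mul] at h1
    have h2 := le_opNorm_apply A (quarterTurn s)
    rw [norm_quarterTurn, hs.1, mul_one] at h2
    have h3 : (0 : ℝ) < ‖(A.symm : Plane →L[ℝ] Plane)‖⁻¹ := by positivity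
    have h4 := abs_nonneg (area s e)
    nlinarith
  have hq := le_opNorm_apply A (quarterTurn e)
  rw [norm_quarterTurn, he.1, mul_one] at hq
  rw [hdec, map_add, map_smul, map_smul]
  refine (norm_add_le _ _).trans ?_
  rw [norm_smul, norm_smul, Real.norm_eq_abs, Real.norm_eq_abs]
  calc _ ≤ (‖(B : Plane →L[ℝ] Plane)‖ * ‖x‖) * (‖(A.symm : Plane →L[ℝ] Plane)‖⁻¹ +
      ‖(A : Plane →L[ℝ] Plane)‖ * |area s e|) +
      (‖(B.symm : Plane →L[ℝ] Plane)‖⁻¹ * ‖x‖) * ‖(A : Plane →L[ℝ] Plane)‖ := by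
        gcongr
    _ = _ := by
      unfold dilatation
      field_simp
      ring

/-- A near alignment of `e` with `s` destroys eccentricity as well as norm. Domination forbids this,
which is how angles are bounded below. -/
theorem dilatation_mul_le_of_isContracted {A B : Plane ≃L[ℝ] Plane} {s e : Plane}
    (hs : IsContracted A s) (he : IsContracted B⁻¹ e) :
    dilatation (A * B) ≤ (|area s e| + (dilatation A)⁻¹ + (dilatation B)⁻¹) ^ 2 *
      (dilatation A * dilatation B) := by
  have h1 := opNorm_mul_le_of_isContracted hs he
  have h2 := pow_le_pow_left₀ (norm_nonneg _) h1 2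
  rw [mul_pow, mul_pow, opNorm_sq_eq, opNorm_sq_eq, opNorm_sq_eq, planeDet_mul, abs_mul] at h2
  have hA : 0 < |planeDet A| := abs_pos.2 (planeDet_ne_zero A)
  have hB : 0 < |planeDet B| := abs_pos.2 (planeDet_ne_zero B)
  refine le_of_mul_le_mul_left ?_ (mul_pos hA hB)
  refine h2.trans_eq ?_
  ring

/-! ### Almost multiplicativity of norms under domination -/

section Words

variable {ι : Type*} (A : ι → (Plane ≃L[ℝ] Plane))

/-- A long word has a suffix with dilatation comparable to a prescribed level, whose contracted
direction is close to that of the whole word. -/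
theorem exists_suffix_dilatation {M C ρ L : ℝ} {n : ℕ} (hM : ∀ i, dilatation (A i) ≤ M)
    (hM1 : 1 ≤ M) (hC : 0 < C) (hρ : 1 < ρ) (hL : 1 ≤ L)
    (hdom : ∀ w : List ι, ρ ^ w.length ≤ C * dilatation (w.map A).prod)
    (w : List ι) (hw : L < dilatation (w.map A).prod) :
    ∃ t : List ι, dilatation (t.map A).prod ≤ L ∧ L < M * dilatation (t.map A).prod ∧
      ∀ s s', IsContracted (t.map A).prod s → IsContracted (w.map A).prod s' →
        |area s s'| ≤ ∑ k ∈ Finset.range w.length,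
          M * (if k < n then M / L else C * (ρ⁻¹) ^ k) := by
  have hρ0 : 0 < ρ := by linarith
  have hM0 : 0 < M := by linarith
  have hL0 : 0 < L := by linarith
  induction w with
  | nil =>
    rw [List.map_nil, List.prod_nil, dilatation_one] at hw
    linarith
  | cons a w ih =>
    have hmul : dilatation ((a :: w).map A).prod ≤ M * dilatation (w.map A).prod := by
      rw [List.map_cons, List.prod_cons]
      refine (dilatation_mul_le _ _).trans ?_
      gcongr
      · exact (dilatation_pos _).le
      · exact hM a
    have hpos := dilatation_pos (w.map A).prod
    have hstep : ∀ s s', IsContracted (w.map A).prod s → IsContracted ((a :: w).map A).prod s' →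
        |area s s'| ≤ M * (if w.length < n then M / L else C * (ρ⁻¹) ^ w.length) := by
      intro s s' hs hs'
      rw [List.map_cons, List.prod_cons] at hs'
      refine (hs.abs_area_le_div hs').trans ?_
      rw [div_eq_mul_inv]
      have h1 : (dilatation (w.map A).prod)⁻¹ ≤
          if w.length < n then M / L else C * (ρ⁻¹) ^ w.length := by
        split_ifs with h
        · rw [inv_le_comm₀ hpos (by positivity), inv_div, div_le_iff₀ hM0]
          linarith
        · have h2 := hdom w
          rw [inv_pow, ← div_eq_mul_inv, inv_eq_one_div, div_le_div_iff₀ hpos (by positivity)]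
          linarith
      gcongr
      exact hM a
    have hnn : ∀ k, 0 ≤ M * (if k < n then M / L else C * (ρ⁻¹) ^ k) := by
      intro k
      split_ifs <;> positivity
    rw [List.length_cons]
    -- Letters are peeled off on the left until the dilatation first drops to `L`. One letter costs
    -- a factor at most `M`, and each peeling turns the contracted direction by at most the
    -- corresponding summand.
    by_cases hc : dilatation (w.map A).prod ≤ L
    · refine ⟨w, hc, hw.trans_le hmul, fun s s' hs hs' => (hstep s s' hs hs').trans ?_⟩
      exact Finset.single_le_sum (f := fun k => M * (if k < n then M / L else C * (ρ⁻¹) ^ k))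
        (fun k _ => hnn k) (Finset.self_mem_range_succ _)
    · obtain ⟨t, ht1, ht2, ht3⟩ := ih (not_le.1 hc)
      refine ⟨t, ht1, ht2, fun s s' hs hs' => ?_⟩
      obtain ⟨s'', hs''⟩ := exists_isContracted (w.map A).prod
      rw [Finset.sum_range_succ]
      exact (area_sub_triangle s s'' s' hs.1.le hs''.1 hs'.1.le).trans
        (add_le_add (ht3 s s'' hs hs'') (hstep s'' s' hs'' hs'))

/-- The crude bound is used only for `n` terms and the geometric tail starts at `ρ ^ (-n)`. The
total turning is therefore `O(n / ρ ^ n)`, only linearly worse than the level `1 / ρ ^ n`. -/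
theorem sum_min_le {M C ρ : ℝ} {n : ℕ} (hM1 : 1 ≤ M) (hC : 0 < C) (hρ : 1 < ρ) (m : ℕ) :
    ∑ k ∈ Finset.range m, M * (if k < n then M / ρ ^ n else C * (ρ⁻¹) ^ k) ≤
      (M ^ 2 * n + M * C * (1 - ρ⁻¹)⁻¹) / ρ ^ n := by
  have hρ0 : 0 < ρ := by linarith
  have hM0 : 0 < M := by linarith
  have hr : ρ⁻¹ < 1 := inv_lt_one_of_one_lt₀ hρ
  have hnn : ∀ k, 0 ≤ M * (if k < n then M / ρ ^ n else C * (ρ⁻¹) ^ k) := by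
    intro k
    split_ifs <;> positivity
  have h1 : ∑ k ∈ Finset.range m, M * (if k < n then M / ρ ^ n else C * (ρ⁻¹) ^ k) ≤
      ∑ k ∈ Finset.range (n + m), M * (if k < n then M / ρ ^ n else C * (ρ⁻¹) ^ k) :=
    Finset.sum_le_sum_of_subset_of_nonneg (Finset.range_mono (by omega)) fun k _ _ => hnn k
  refine h1.trans ?_
  rw [Finset.sum_range_add]
  have h2 : ∑ k ∈ Finset.range n, M * (if k < n then M / ρ ^ n else C * (ρ⁻¹) ^ k) =
      M ^ 2 * n / ρ ^ n := by
    rw [Finset.sum_congr rfl (g := fun _ => M * (M / ρ ^ n))]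
    · rw [Finset.sum_const, Finset.card_range, nsmul_eq_mul]; ring
    · intro k hk
      rw [if_pos (Finset.mem_range.1 hk)]
  have h3 : ∑ k ∈ Finset.range m, M * (if n + k < n then M / ρ ^ n else C * (ρ⁻¹) ^ (n + k)) =
      M * C * (ρ⁻¹) ^ n * ∑ k ∈ Finset.range m, (ρ⁻¹) ^ k := by
    rw [Finset.mul_sum]
    refine Finset.sum_congr rfl fun k _ => ?_
    rw [if_neg (by omega), pow_add]; ring
  have h4 : ∑ k ∈ Finset.range m, (ρ⁻¹) ^ k ≤ (1 - ρ⁻¹)⁻¹ := by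
    rw [← tsum_geometric_of_lt_one (by positivity) hr]
    exact (summable_geometric_of_lt_one (by positivity) hr).sum_le_tsum _
      fun k _ => by positivity
  rw [h2, h3, add_div]
  gcongr
  calc _ ≤ M * C * (ρ⁻¹) ^ n * (1 - ρ⁻¹)⁻¹ := by gcongr
    _ = _ := by rw [inv_pow]; field_simp

theorem dilatation_prod_le {M : ℝ} (hM : ∀ i, dilatation (A i) ≤ M) (hM1 : 1 ≤ M)
    (w : List ι) : dilatation (w.map A).prod ≤ M ^ w.length := by
  induction w with
  | nil => simp [dilatation_one]
  | cons a w ih =>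
    rw [List.map_cons, List.prod_cons, List.length_cons, pow_succ']
    refine (dilatation_mul_le _ _).trans ?_
    gcongr
    · exact (dilatation_pos _).le
    · exact hM a

/-- Products of a dominated family are almost multiplicative for the operator norm. -/
theorem exists_le_opNorm_mul [Finite ι] {C ρ : ℝ} (hC : 0 < C) (hρ : 1 < ρ)
    (hdom : ∀ w : List ι, ρ ^ w.length ≤ C * dilatation (w.map A).prod) :
    ∃ κ : ℝ, 0 < κ ∧ ∀ u w : List ι,
      κ * (‖((u.map A).prod : Plane →L[ℝ] Plane)‖ * ‖((w.map A).prod : Plane →L[ℝ] Plane)‖) ≤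
        ‖(((u.map A).prod * (w.map A).prod : Plane ≃L[ℝ] Plane) : Plane →L[ℝ] Plane)‖ := by
  have hρ0 : 0 < ρ := by linarith
  obtain ⟨M, hM1, hM⟩ : ∃ M : ℝ, 1 ≤ M ∧ ∀ i, dilatation (A i) ≤ M := by
    obtain ⟨M, hM⟩ := (Set.finite_range fun i => dilatation (A i)).bddAbove
    exact ⟨max 1 M, le_max_left _ _, fun i => (hM ⟨i, rfl⟩).trans (le_max_right _ _)⟩
  have hM0 : 0 < M := by linarith
  -- With `M < ρ ^ p`, a dilatation above `ρ ^ (p * k) / M` requires at least `k` letters.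
  obtain ⟨p, hp⟩ := pow_unbounded_of_one_lt M hρ
  set c₁ : ℝ := 2 * M ^ 2 * p
  set c₂ : ℝ := 2 * (M * C * (1 - ρ⁻¹)⁻¹) + 1 + 2 * M
  -- Exponential growth beats the square of the linear turning bound; this is the contradiction
  -- aimed at in `hlow`.
  obtain ⟨k, hk⟩ : ∃ k : ℕ, C * (c₁ * k + c₂) ^ 2 < ρ ^ (2 * k) := by
    have h1 : Filter.Tendsto (fun k : ℕ => C * (c₁ * ((k : ℝ) ^ 1 / ρ ^ k) +
        c₂ * ((k : ℝ) ^ 0 / ρ ^ k)) ^ 2) Filter.atTop (𝓝 (C * (c₁ * 0 + c₂ * 0) ^ 2)) :=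
      ((((tendsto_pow_const_div_const_pow_of_one_lt 1 hρ).const_mul _).add
        ((tendsto_pow_const_div_const_pow_of_one_lt 0 hρ).const_mul _)).pow 2).const_mul _
    have h2 : C * (c₁ * 0 + c₂ * 0) ^ 2 < 1 := by simp
    obtain ⟨k, hk⟩ := (h1.eventually (gt_mem_nhds h2)).exists
    refine ⟨k, ?_⟩
    have hpos : 0 < ρ ^ k := by positivity
    have h3 : C * (c₁ * ((k : ℝ) ^ 1 / ρ ^ k) + c₂ * ((k : ℝ) ^ 0 / ρ ^ k)) ^ 2 =
        C * (c₁ * k + c₂) ^ 2 / ρ ^ (2 * k) := by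
      rw [pow_mul', pow_one, pow_zero]
      field_simp
    rw [h3, div_lt_one (by positivity)] at hk
    exact hk
  set n := p * k with hn
  set L : ℝ := ρ ^ n with hLdef
  have hL : 1 ≤ L := one_le_pow₀ hρ.le
  have hL0 : 0 < L := by positivity
  have hlen : ∀ (B : ι → (Plane ≃L[ℝ] Plane)) (t : List ι), (∀ i, dilatation (B i) ≤ M) →
      L < M * dilatation (t.map B).prod → k ≤ t.length := by
    intro B t hB ht
    have h1 := dilatation_prod_le B hB hM1 t
    have h2 : ρ ^ (p * k) < ρ ^ (p * (t.length + 1)) :=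
      calc ρ ^ (p * k) < M * M ^ t.length := ht.trans_le (by gcongr)
        _ = M ^ (t.length + 1) := by ring
        _ ≤ (ρ ^ p) ^ (t.length + 1) := by gcongr
        _ = _ := by rw [pow_mul]
    have h3 := (pow_lt_pow_iff_right₀ hρ).1 h2
    have h4 := lt_of_mul_lt_mul_left h3 (Nat.zero_le p)
    omega
  refine ⟨L⁻¹, by positivity, fun u w => ?_⟩
  rw [inv_mul_le_iff₀ hL0]
  set U := (u.map A).prod with hU
  set W := (w.map A).prod with hW
  -- If either factor has dilatation at most `L`, cancelling it costs only `L`. The substantial case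
  -- has both factors very eccentric.
  by_cases hu : dilatation U ≤ L
  · have h1 := opNorm_le_opNorm_mul U W
    calc ‖(U : Plane →L[ℝ] Plane)‖ * ‖(W : Plane →L[ℝ] Plane)‖
        ≤ ‖(U : Plane →L[ℝ] Plane)‖ * (‖(U.symm : Plane →L[ℝ] Plane)‖ *
          ‖((U * W : Plane ≃L[ℝ] Plane) : Plane →L[ℝ] Plane)‖) := by gcongr
      _ = dilatation U * ‖((U * W : Plane ≃L[ℝ] Plane) : Plane →L[ℝ] Plane)‖ := by
        rw [dilatation]; ring
      _ ≤ _ := by gcongr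
  by_cases hw : dilatation W ≤ L
  · have h1 := opNorm_le_mul_opNorm U W
    calc ‖(U : Plane →L[ℝ] Plane)‖ * ‖(W : Plane →L[ℝ] Plane)‖
        ≤ (‖((U * W : Plane ≃L[ℝ] Plane) : Plane →L[ℝ] Plane)‖ *
          ‖(W.symm : Plane →L[ℝ] Plane)‖) * ‖(W : Plane →L[ℝ] Plane)‖ := by gcongr
      _ = dilatation W * ‖((U * W : Plane ≃L[ℝ] Plane) : Plane →L[ℝ] Plane)‖ := by
        rw [dilatation]; ring
      _ ≤ _ := by gcongr
  -- Inverting and reversing turns prefixes of `w` into suffixes, so the suffix lemma applies to the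
  -- second factor too.
  set A' : ι → (Plane ≃L[ℝ] Plane) := fun i => (A i)⁻¹ with hA'
  have hinv : ∀ t : List ι, (t.map A').prod = ((t.reverse.map A).prod)⁻¹ := by
    intro t
    rw [List.prod_inv_reverse, List.map_map, List.map_reverse, List.reverse_reverse]
    rfl
  have hM' : ∀ i, dilatation (A' i) ≤ M := fun i => by
    rw [hA', dilatation_inv]; exact hM i
  have hdom' : ∀ t : List ι, ρ ^ t.length ≤ C * dilatation (t.map A').prod := fun t => by
    rw [hinv, dilatation_inv, ← List.length_reverse]; exact hdom _
  have hw' : (w.reverse.map A').prod = W⁻¹ := by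
    rw [hinv, List.reverse_reverse]
  obtain ⟨t, ht1, ht2, ht3⟩ := exists_suffix_dilatation A (n := n) hM hM1 hC hρ hL hdom u
    (not_le.1 hu)
  obtain ⟨t', ht1', ht2', ht3'⟩ := exists_suffix_dilatation A' (n := n) hM' hM1 hC hρ hL hdom'
    w.reverse (by rw [hw', dilatation_inv]; exact not_le.1 hw)
  have hT := hlen A t hM ht2
  have hT' := hlen A' t' hM' ht2'
  obtain ⟨s, hs⟩ := exists_isContracted U
  obtain ⟨e, he⟩ := exists_isContracted W⁻¹
  obtain ⟨s', hs'⟩ := exists_isContracted (t.map A).prod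
  obtain ⟨e', he'⟩ := exists_isContracted (t'.map A').prod
  have hss := (ht3 s' s hs' hs).trans (sum_min_le hM1 hC hρ _)
  have hee := (ht3' e' e he' (hw'.symm ▸ he)).trans (sum_min_le hM1 hC hρ _)
  -- If the angle were below `1 / L`, the junction piece `T * T'` would have dilatation at most `(c₁
  -- * k + c₂) ^ 2`, although it has at least `2 * k` letters.
  have hlow : 1 ≤ L * |area s e| := by
    by_contra! hlt
    rw [hinv] at he' ht1' ht2'
    rw [dilatation_inv] at ht1' ht2'
    set T := (t.map A).prod
    set T' := (t'.reverse.map A).prod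
    have hTT : T * T' = ((t ++ t'.reverse).map A).prod := by
      rw [List.map_append, List.prod_append]
    have h1 := dilatation_mul_le_of_isContracted hs' he'
    have h2 := hdom (t ++ t'.reverse)
    rw [← hTT, List.length_append, List.length_reverse] at h2
    have hTp := dilatation_pos T
    have hTp' := dilatation_pos T'
    have h3 : |area s' e'| ≤ |area s' s| + (|area s e| + |area e e'|) :=
      (area_sub_triangle s' s e' hs'.1.le hs.1 he'.1.le).trans (by
        gcongr
        exact area_sub_triangle s e e' hs.1.le he.1 he'.1.le)
    rw [area_comm e' e, abs_neg] at hee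
    have hinvT : (dilatation T)⁻¹ ≤ M / L := by
      rw [inv_le_comm₀ hTp (by positivity), inv_div, div_le_iff₀ hM0]; linarith
    have hinvT' : (dilatation T')⁻¹ ≤ M / L := by
      rw [inv_le_comm₀ hTp' (by positivity), inv_div, div_le_iff₀ hM0]; linarith
    have hlt' : |area s e| ≤ 1 / L := by
      rw [le_div_iff₀ hL0]; linarith
    have h4 : |area s' e'| + (dilatation T)⁻¹ + (dilatation T')⁻¹ ≤ (c₁ * k + c₂) / L := by
      calc _ ≤ ((M ^ 2 * n + M * C * (1 - ρ⁻¹)⁻¹) / L +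
            (1 / L + (M ^ 2 * n + M * C * (1 - ρ⁻¹)⁻¹) / L)) + M / L + M / L := by
              linarith
        _ = _ := by
          rw [hn]; push_cast; simp only [c₁, c₂]; ring
    have h5 : dilatation (T * T') ≤ (c₁ * k + c₂) ^ 2 := by
      calc _ ≤ _ := h1
        _ ≤ ((c₁ * k + c₂) / L) ^ 2 * (L * L) := by gcongr
        _ = _ := by field_simp
    have h6 : ρ ^ (2 * k) ≤ ρ ^ (t.length + t'.length) :=
      pow_le_pow_right₀ hρ.le (by omega)
    have h7 : C * dilatation (T * T') ≤ C * (c₁ * k + c₂) ^ 2 := by gcongr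
    linarith
  have h1 := le_opNorm_mul_of_isContracted hs he
  have hUW : 0 ≤ ‖(U : Plane →L[ℝ] Plane)‖ * ‖(W : Plane →L[ℝ] Plane)‖ := by positivity
  calc _ ≤ ‖(U : Plane →L[ℝ] Plane)‖ * ‖(W : Plane →L[ℝ] Plane)‖ * (L * |area s e|) :=
        le_mul_of_one_le_right hUW hlow
    _ = L * (‖(U : Plane →L[ℝ] Plane)‖ * ‖(W : Plane →L[ℝ] Plane)‖ * |area s e|) := by ring
    _ ≤ _ := by gcongr

end Words

/-! ### Furstenberg directions and transversal widths -/

theorem submodule_eq_span_singleton {V : ℙ ℝ Plane} {v : Plane} (hv : v ≠ 0)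
    (hvV : v ∈ V.submodule) : V.submodule = Submodule.span ℝ {v} := by
  rw [Projectivization.submodule_eq] at hvV ⊢
  obtain ⟨c, rfl⟩ := Submodule.mem_span_singleton.1 hvV
  have hc : c ≠ 0 := fun h => hv (by simp [h])
  rw [Submodule.span_singleton_smul_eq (IsUnit.mk0 c hc)]

namespace PlanarAffineIFS

variable {N : ℕ} (F : PlanarAffineIFS N)

theorem wordLinear_cons (i : Fin N) (w : List (Fin N)) :
    F.wordLinear (i :: w) = F.A i * F.wordLinear w := by
  simp [wordLinear]

theorem wordLinear_append (u w : List (Fin N)) :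
    F.wordLinear (u ++ w) = F.wordLinear u * F.wordLinear w := by
  simp [wordLinear]

/-- The operator norm of the linear part along a word. -/
def wordNorm (w : List (Fin N)) : ℝ := ‖(F.wordLinear w : Plane →L[ℝ] Plane)‖

/-- The width of the image of the unit ball under the linear part of a word, transversally to `v`
and scaled by the length of `v`. -/
def width (w : List (Fin N)) (v : Plane) : ℝ :=
  |planeDet (F.wordLinear w)| * ‖(F.wordLinear w).symm v‖

/-- The non-zero vectors that span a Furstenberg direction. -/
def furstenbergVectors : Set Plane :=
  {v | v ≠ 0 ∧ ∃ V ∈ F.furstenbergDirections, v ∈ V.submodule}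

/-- The closure of the set of multiples of products of inverses. -/
def inverseProductsClosure : Set (Plane →L[ℝ] Plane) :=
  closure {B : Plane →L[ℝ] Plane | ∃ (c : ℝ) (w : List (Fin N)),
    B = c • (((F.wordLinear w.reverse)⁻¹ : Plane ≃L[ℝ] Plane) : Plane →L[ℝ] Plane)}

theorem wordNorm_pos (w : List (Fin N)) : 0 < F.wordNorm w := opNorm_pos _

theorem wordNorm_append_le (u w : List (Fin N)) :
    F.wordNorm (u ++ w) ≤ F.wordNorm u * F.wordNorm w := by
  unfold wordNorm
  rw [wordLinear_append]
  exact opNorm_mul_le _ _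

theorem wordNorm_le_one (w : List (Fin N)) : F.wordNorm w ≤ 1 := by
  induction w with
  | nil => exact ContinuousLinearMap.norm_id_le
  | cons i w ih =>
    refine (F.wordNorm_append_le [i] w).trans (mul_le_one₀ ?_ (F.wordNorm_pos w).le ih)
    simpa [wordNorm, wordLinear] using (F.norm_lt_one i).le

theorem width_pos (w : List (Fin N)) {v : Plane} (hv : v ≠ 0) : 0 < F.width w v :=
  mul_pos (abs_pos.2 (planeDet_ne_zero _))
    (norm_pos_iff.2 (by simpa using hv))

theorem width_append (u w : List (Fin N)) (v : Plane) :
    F.width (u ++ w) v =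
      |planeDet (F.wordLinear u)| * F.width w ((F.wordLinear u).symm v) := by
  unfold width
  rw [wordLinear_append, planeDet_mul, abs_mul, mul_assoc]
  rfl

theorem width_smul (w : List (Fin N)) (c : ℝ) (v : Plane) :
    F.width w (c • v) = |c| * F.width w v := by
  unfold width
  rw [map_smul, norm_smul, Real.norm_eq_abs]; ring

theorem width_le (w : List (Fin N)) (v : Plane) : F.width w v ≤ F.wordNorm w * ‖v‖ := by
  unfold width wordNorm
  rw [opNorm_eq_abs_planeDet_mul, mul_assoc]
  gcongr
  exact le_opNorm_apply (F.wordLinear w).symm v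

theorem continuous_width (w : List (Fin N)) : Continuous (F.width w) := by
  unfold width
  fun_prop

theorem abs_area_wordLinear_le (w : List (Fin N)) (v z : Plane) :
    |area v (F.wordLinear w z)| ≤ F.width w v * ‖z‖ := by
  rw [area_apply_right, abs_mul, width, mul_assoc]
  gcongr
  exact abs_area_le _ _

theorem mem_furstenbergVectors {v : Plane} :
    v ∈ F.furstenbergVectors ↔ v ≠ 0 ∧ ∃ B ∈ F.inverseProductsClosure,
      LinearMap.range (B : Plane →ₗ[ℝ] Plane) = Submodule.span ℝ {v} := by
  constructor
  · rintro ⟨hv, V, ⟨B, hB, hBV⟩, hvV⟩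
    refine ⟨hv, B, hB, ?_⟩
    rw [hBV, submodule_eq_span_singleton hv hvV]
  · rintro ⟨hv, B, hB, hBv⟩
    refine ⟨hv, Projectivization.mk ℝ v hv, ⟨B, hB, ?_⟩, ?_⟩
    · rw [hBv, Projectivization.submodule_mk]
    · rw [Projectivization.submodule_mk]
      exact Submodule.mem_span_singleton_self v

theorem smul_mem_furstenbergVectors {v : Plane} (hv : v ∈ F.furstenbergVectors) {c : ℝ}
    (hc : c ≠ 0) : c • v ∈ F.furstenbergVectors :=
  ⟨smul_ne_zero hc hv.1, hv.2.imp fun V h => ⟨h.1, V.submodule.smul_mem c h.2⟩⟩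

/-- Left composition with an inverse word product preserves the closure of scaled inverse products
and moves the range accordingly. -/
theorem symm_mem_furstenbergVectors {v : Plane} (hv : v ∈ F.furstenbergVectors)
    (w : List (Fin N)) : (F.wordLinear w).symm v ∈ F.furstenbergVectors := by
  rw [mem_furstenbergVectors] at hv ⊢
  obtain ⟨hv, B, hB, hBv⟩ := hv
  refine ⟨by simpa using hv, ((F.wordLinear w).symm : Plane →L[ℝ] Plane).comp B, ?_, ?_⟩
  · refine map_mem_closure (f := fun B => ((F.wordLinear w).symm : Plane →L[ℝ] Plane).comp B)
      (by fun_prop) hB ?_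
    rintro _ ⟨c, u, rfl⟩
    refine ⟨c, w.reverse ++ u, ?_⟩
    rw [List.reverse_append, List.reverse_reverse, wordLinear_append, mul_inv_rev]
    ext1 x
    simp
    rfl
  · have h1 : LinearMap.range
        ((((F.wordLinear w).symm : Plane →L[ℝ] Plane).comp B : Plane →L[ℝ] Plane) :
          Plane →ₗ[ℝ] Plane) =
        (LinearMap.range (B : Plane →ₗ[ℝ] Plane)).map
          (((F.wordLinear w).symm : Plane →L[ℝ] Plane) : Plane →ₗ[ℝ] Plane) :=
      LinearMap.range_comp _ _
    rw [h1, hBv, Submodule.map_span, Set.image_singleton]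
    rfl

variable {F}

theorem IsDominated.exists_pow_le (h : F.IsDominated) :
    ∃ C ρ : ℝ, 0 < C ∧ 1 < ρ ∧
      ∀ w : List (Fin N), ρ ^ w.length ≤ C * dilatation (F.wordLinear w) := by
  obtain ⟨C, τ, hC, hτ, hτ1, h⟩ := h
  refine ⟨C, τ⁻¹, hC, (one_lt_inv₀ hτ).2 hτ1, fun w => ?_⟩
  have h1 := h w
  unfold singularMin singularMax at h1
  have hp := opNorm_pos (F.wordLinear w).symm
  rw [inv_le_iff_one_le_mul₀ hp] at h1
  rw [inv_pow, inv_le_iff_one_le_mul₀ (by positivity)]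
  unfold dilatation
  linarith

/-- On Furstenberg directions the inverse products expand at the rate of their norm. -/
theorem IsDominated.exists_le_norm_symm_apply (h : F.IsDominated) :
    ∃ κ : ℝ, 0 < κ ∧ ∀ v ∈ F.furstenbergVectors, ∀ w : List (Fin N),
      κ * (‖((F.wordLinear w).symm : Plane →L[ℝ] Plane)‖ * ‖v‖) ≤ ‖(F.wordLinear w).symm v‖ := by
  obtain ⟨C, ρ, hC, hρ, hdom⟩ := h.exists_pow_le
  obtain ⟨κ, hκ, hmul⟩ := exists_le_opNorm_mul F.A hC hρ hdom
  refine ⟨κ, hκ, fun v hv w => ?_⟩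
  obtain ⟨hv, B, hB, hBv⟩ := F.mem_furstenbergVectors.1 hv
  set D : Plane →L[ℝ] Plane := ((F.wordLinear w).symm : Plane →L[ℝ] Plane) with hD
  -- Almost multiplicativity passes to inverses after division by determinants, and to limits
  -- because both sides are continuous.
  have hcl : κ * (‖D‖ * ‖B‖) ≤ ‖D.comp B‖ := by
    refine closure_minimal (t := {B | κ * (‖D‖ * ‖B‖) ≤ ‖D.comp B‖}) ?_
      (isClosed_le (by fun_prop) (by fun_prop)) hB
    rintro _ ⟨c, u, rfl⟩
    rw [Set.mem_ofPred_eq, ContinuousLinearMap.comp_smul, norm_smul, norm_smul]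
    have h1 : κ * (‖(F.wordLinear u.reverse : Plane →L[ℝ] Plane)‖ *
        ‖(F.wordLinear w : Plane →L[ℝ] Plane)‖) ≤ _ := hmul u.reverse w
    change _ ≤ ‖((F.wordLinear u.reverse * F.wordLinear w : Plane ≃L[ℝ] Plane) :
      Plane →L[ℝ] Plane)‖ at h1
    rw [opNorm_eq_abs_planeDet_mul (F.wordLinear u.reverse),
      opNorm_eq_abs_planeDet_mul (F.wordLinear w),
      opNorm_eq_abs_planeDet_mul (F.wordLinear u.reverse * F.wordLinear w), planeDet_mul,
      abs_mul] at h1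
    have hp1 : 0 < |planeDet (F.wordLinear u.reverse)| := abs_pos.2 (planeDet_ne_zero _)
    have hp2 : 0 < |planeDet (F.wordLinear w)| := abs_pos.2 (planeDet_ne_zero _)
    have h2 : κ * (‖D‖ * ‖((F.wordLinear u.reverse).symm : Plane →L[ℝ] Plane)‖) ≤
        ‖D.comp ((F.wordLinear u.reverse).symm : Plane →L[ℝ] Plane)‖ := by
      refine le_of_mul_le_mul_left ?_ (mul_pos hp1 hp2)
      refine le_trans (le_of_eq ?_) h1
      ring
    calc _ = ‖c‖ * (κ * (‖D‖ * ‖((F.wordLinear u.reverse).symm : Plane →L[ℝ] Plane)‖)) := by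
          ring_nf; rfl
      _ ≤ _ := mul_le_mul_of_nonneg_left h2 (norm_nonneg c)
  have hvp : 0 < ‖v‖ := norm_pos_iff.2 hv
  have hB0 : 0 < ‖B‖ := by
    rw [norm_pos_iff]
    rintro rfl
    have : v ∈ LinearMap.range ((0 : Plane →L[ℝ] Plane) : Plane →ₗ[ℝ] Plane) := by
      rw [hBv]; exact Submodule.mem_span_singleton_self v
    obtain ⟨x, hx⟩ := this
    exact hv (by simpa using hx.symm)
  -- The range of `B` is the line of `v`, so composing with `D` rescales `B` exactly as it rescales
  -- `v`.
  have hup : ‖D.comp B‖ ≤ ‖B‖ * (‖D v‖ / ‖v‖) := by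
    refine ContinuousLinearMap.opNorm_le_bound _ (by positivity) fun x => ?_
    have hx : B x ∈ Submodule.span ℝ {v} := by
      rw [← hBv]; exact ⟨x, rfl⟩
    obtain ⟨b, hb⟩ := Submodule.mem_span_singleton.1 hx
    have hbx := B.le_opNorm x
    rw [ContinuousLinearMap.comp_apply, ← hb, map_smul, norm_smul]
    rw [← hb, norm_smul] at hbx
    calc ‖b‖ * ‖D v‖ = (‖b‖ * ‖v‖) * (‖D v‖ / ‖v‖) := by field_simp
      _ ≤ (‖B‖ * ‖x‖) * (‖D v‖ / ‖v‖) := by gcongr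
      _ = _ := by ring
  have h3 := hcl.trans hup
  have h4 : κ * ‖D‖ ≤ ‖D v‖ / ‖v‖ := by
    refine le_of_mul_le_mul_left ?_ hB0
    linarith
  rw [le_div_iff₀ hvp] at h4
  change _ ≤ ‖D v‖
  linarith

/-- Every Furstenberg direction attracts all the others along suitable words. -/
theorem IsDominated.exists_smul_symm_mem (h : F.IsDominated) {v : Plane}
    (hv : v ∈ F.furstenbergVectors) {U : Set Plane} (hU : U ∈ 𝓝 v) :
    ∃ u : List (Fin N), ∀ v' ∈ F.furstenbergVectors,
      ∃ c : ℝ, c ≠ 0 ∧ c • (F.wordLinear u).symm v' ∈ U := by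
  obtain ⟨κ, hκ, hexp⟩ := h.exists_le_norm_symm_apply
  obtain ⟨hv0, B, hB, hBv⟩ := F.mem_furstenbergVectors.1 hv
  obtain ⟨ε, hε, hεU⟩ := Metric.mem_nhds_iff.1 hU
  have hvp : 0 < ‖v‖ := norm_pos_iff.2 hv0
  have hB0 : 0 < ‖B‖ := by
    rw [norm_pos_iff]
    rintro rfl
    have : v ∈ LinearMap.range ((0 : Plane →L[ℝ] Plane) : Plane →ₗ[ℝ] Plane) := by
      rw [hBv]; exact Submodule.mem_span_singleton_self v
    obtain ⟨x, hx⟩ := this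
    exact hv0 (by simpa using hx.symm)
  -- The first bound keeps `B v'` away from zero, uniformly in `v'`; the second makes the normalised
  -- error smaller than `ε`.
  obtain ⟨δ, hδ, hδ1, hδ2⟩ : ∃ δ : ℝ, 0 < δ ∧ δ ≤ κ * ‖B‖ / (2 * (κ + 1)) ∧
      δ ≤ ε * (κ * ‖B‖) / (4 * ‖v‖) :=
    ⟨min (κ * ‖B‖ / (2 * (κ + 1))) (ε * (κ * ‖B‖) / (4 * ‖v‖)), by positivity,
      min_le_left _ _, min_le_right _ _⟩
  obtain ⟨_, ⟨c, w, rfl⟩, hdist⟩ := Metric.mem_closure_iff.1 hB δ hδ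
  rw [dist_eq_norm] at hdist
  refine ⟨w.reverse, fun v' hv' => ?_⟩
  set D : Plane →L[ℝ] Plane := ((F.wordLinear w.reverse).symm : Plane →L[ℝ] Plane) with hD
  change ‖B - c • D‖ < δ at hdist
  have hv'p : 0 < ‖v'‖ := norm_pos_iff.2 hv'.1
  have h1 : κ * (‖D‖ * ‖v'‖) ≤ ‖D v'‖ := hexp v' hv' w.reverse
  have hx : B v' ∈ Submodule.span ℝ {v} := by
    rw [← hBv]; exact ⟨v', rfl⟩
  obtain ⟨b, hb⟩ := Submodule.mem_span_singleton.1 hx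
  have h2 : ‖B v' - c • D v'‖ ≤ δ * ‖v'‖ :=
    ((B - c • D).le_opNorm v').trans (by gcongr)
  have h3 : ‖B‖ - δ ≤ ‖c‖ * ‖D‖ := by
    have := norm_sub_norm_le B (c • D)
    rw [norm_smul] at this
    linarith
  -- No Furstenberg vector is near the kernel of `B`: `D` expands `v'` at full rate and `c • D` is
  -- close to `B`.
  have h4 : κ * (‖B‖ - δ) * ‖v'‖ - δ * ‖v'‖ ≤ ‖b‖ * ‖v‖ := by
    have h5 := norm_sub_norm_le (c • D v') (B v')
    rw [norm_sub_rev] at h5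
    rw [norm_smul, ← hb, norm_smul, hb] at h5
    have h6 : κ * (‖B‖ - δ) * ‖v'‖ ≤ ‖c‖ * ‖D v'‖ :=
      calc _ ≤ κ * (‖c‖ * ‖D‖) * ‖v'‖ := by gcongr
        _ = ‖c‖ * (κ * (‖D‖ * ‖v'‖)) := by ring
        _ ≤ _ := by gcongr
    linarith
  have h5 : κ * ‖B‖ / 2 * ‖v'‖ ≤ ‖b‖ * ‖v‖ := by
    refine le_trans ?_ h4
    rw [le_div_iff₀ (by positivity)] at hδ1
    nlinarith
  have hb0 : 0 < ‖b‖ := by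
    have : 0 < ‖b‖ * ‖v‖ := lt_of_lt_of_le (by positivity) h5
    exact pos_of_mul_pos_left this hvp.le
  have hbne : b ≠ 0 := norm_pos_iff.1 hb0
  have hc0 : c ≠ 0 := by
    rintro rfl
    rw [norm_zero, zero_mul] at h3
    rw [le_div_iff₀ (by positivity)] at hδ1
    nlinarith
  refine ⟨b⁻¹ * c, mul_ne_zero (inv_ne_zero hbne) hc0, hεU ?_⟩
  rw [Metric.mem_ball, dist_eq_norm]
  have h6 : (b⁻¹ * c) • (F.wordLinear w.reverse).symm v' - v = -(b⁻¹ • (B v' - c • D v')) := by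
    rw [← hb, smul_sub, inv_smul_smul₀ hbne, smul_smul, neg_sub]
    rfl
  rw [h6, norm_neg, norm_smul, norm_inv]
  rw [inv_mul_lt_iff₀ hb0]
  refine h2.trans_lt ?_
  rw [le_div_iff₀ (by positivity)] at hδ2
  have h7 : ε * (κ * ‖B‖) * ‖v'‖ ≤ 2 * (‖b‖ * ε) * ‖v‖ := by nlinarith
  have h8 : δ * (4 * ‖v‖) * ‖v'‖ ≤ ε * (κ * ‖B‖) * ‖v'‖ := by gcongr
  have h9 : 0 < (‖b‖ * ε) * ‖v‖ := by positivity
  refine lt_of_mul_lt_mul_right (a := ‖v‖) ?_ hvp.le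
  linarith

theorem projectivization_eq_of_area_eq_zero {V W : ℙ ℝ Plane} {v w : Plane} (hv : v ≠ 0) (hw : w ≠ 0)
    (hvV : v ∈ V.submodule) (hwW : w ∈ W.submodule) (h : area v w = 0) : V = W := by
  apply Projectivization.submodule_injective
  rw [submodule_eq_span_singleton hv hvV, submodule_eq_span_singleton hw hwW]
  have h1 := norm_sq_smul_eq w v
  rw [h, zero_smul, add_zero] at h1
  have hvn : ‖v‖ ^ 2 ≠ 0 := by simpa using hv
  have h2 : w = ((‖v‖ ^ 2)⁻¹ * (inner ℝ v w : ℝ)) • v := by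
    rw [mul_smul, ← h1, inv_smul_smul₀ hvn]
  have hc : ((‖v‖ ^ 2)⁻¹ * (inner ℝ v w : ℝ)) ≠ 0 := by
    intro h0
    rw [h0, zero_smul] at h2
    exact hw h2
  rw [h2, Submodule.span_singleton_smul_eq (IsUnit.mk0 _ hc)]

/-- The set of Furstenberg directions has no isolated points unless it is a singleton. -/
theorem IsDominated.exists_mem_area_ne_zero (h : F.IsDominated)
    (hXF : ¬ ∃ V, F.furstenbergDirections = {V}) {v : Plane} (hv : v ∈ F.furstenbergVectors)
    {U : Set Plane} (hU : U ∈ 𝓝 v) {z : Plane} (hz : z ≠ 0) :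
    ∃ v' ∈ F.furstenbergVectors, v' ∈ U ∧ area v' z ≠ 0 := by
  obtain ⟨v₁, hv₁, v₂, hv₂, h12⟩ : ∃ v₁ ∈ F.furstenbergVectors, ∃ v₂ ∈ F.furstenbergVectors,
      area v₁ v₂ ≠ 0 := by
    by_contra! hall
    obtain ⟨hv0, V, hV, hvV⟩ := hv
    refine hXF ⟨V, Set.eq_singleton_iff_unique_mem.2 ⟨hV, fun W hW => ?_⟩⟩
    have hWm : W.rep ∈ W.submodule := by
      rw [Projectivization.submodule_eq]; exact Submodule.mem_span_singleton_self _
    exact projectivization_eq_of_area_eq_zero W.rep_nonzero hv0 hWm hvV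
      (hall _ ⟨W.rep_nonzero, W, hW, hWm⟩ _ ⟨hv0, V, hV, hvV⟩)
  obtain ⟨u, hu⟩ := h.exists_smul_symm_mem hv hU
  obtain ⟨c₁, hc₁, h₁⟩ := hu v₁ hv₁
  obtain ⟨c₂, hc₂, h₂⟩ := hu v₂ hv₂
  have hS₁ := F.smul_mem_furstenbergVectors (F.symm_mem_furstenbergVectors hv₁ u) hc₁
  have hS₂ := F.smul_mem_furstenbergVectors (F.symm_mem_furstenbergVectors hv₂ u) hc₂
  -- Both images lie in `U` and remain independent, so at most one of them is parallel to `z`.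
  by_cases ha : area (c₁ • (F.wordLinear u).symm v₁) z = 0
  · refine ⟨_, hS₂, h₂, fun hb => h12 ?_⟩
    rw [area_smul_left, mul_eq_zero, or_iff_right hc₁] at ha
    rw [area_smul_left, mul_eq_zero, or_iff_right hc₂] at hb
    have h3 := norm_sq_smul_eq ((F.wordLinear u).symm v₁) z
    have h4 := norm_sq_smul_eq ((F.wordLinear u).symm v₂) z
    rw [area_comm, ha, neg_zero, zero_smul, add_zero] at h3
    rw [area_comm, hb, neg_zero, zero_smul, add_zero] at h4
    have h5 : area (‖z‖ ^ 2 • (F.wordLinear u).symm v₁) (‖z‖ ^ 2 • (F.wordLinear u).symm v₂) =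
        0 := by
      rw [h3, h4, area_smul_left, area_smul_right, area_self]; ring
    have hz2 : ‖z‖ ^ 2 ≠ 0 := by simpa using hz
    rw [area_smul_left, area_smul_right, area_map, mul_eq_zero, or_iff_right hz2, mul_eq_zero,
      or_iff_right hz2, mul_eq_zero, or_iff_right (planeDet_ne_zero _)] at h5
    exact h5
  · exact ⟨_, hS₁, h₁, ha⟩

end PlanarAffineIFS

/-! ### Cylinder maps and failure of the projective open set condition -/

/-- On the differences of a fixed planar set, linear functionals are Lipschitz with a constant
controlled by their size. -/
theorem exists_lipschitz_of_bounded {X : Set Plane} (hX : X.Nontrivial) :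
    ∃ C : ℝ, 0 < C ∧ ∀ (g : Plane →ₗ[ℝ] ℝ) (M : ℝ), (∀ x ∈ X, ∀ y ∈ X, |g (x - y)| ≤ M) →
      ∀ x ∈ X, ∀ y ∈ X, |g (x - y)| ≤ C * M * ‖x - y‖ := by
  -- Differences of `X` either contain a basis, and Cramer's rule applies, or all lie on one line.
  by_cases h : ∃ x₁ ∈ X, ∃ y₁ ∈ X, ∃ x₂ ∈ X, ∃ y₂ ∈ X, area (x₁ - y₁) (x₂ - y₂) ≠ 0
  · obtain ⟨x₁, hx₁, y₁, hy₁, x₂, hx₂, y₂, hy₂, hne⟩ := h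
    set p := x₁ - y₁
    set q := x₂ - y₂
    have hp : 0 < |area p q| := abs_pos.2 hne
    refine ⟨(‖p‖ + ‖q‖ + 1) / |area p q|, by positivity, fun g M hg x hx y hy => ?_⟩
    have hM : 0 ≤ M := (abs_nonneg _).trans (hg x hx y hy)
    set z := x - y
    have hz : area p q • z = area z q • p + area p z • q := by
      ext i
      fin_cases i <;> simp [area] <;> ring
    have h1 : area p q * g z = area z q * g p + area p z * g q := by
      simpa using congrArg g hz
    have h2 : |area p q| * |g z| ≤ (‖z‖ * ‖q‖) * M + (‖p‖ * ‖z‖) * M := by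
      rw [← abs_mul, h1]
      refine (abs_add_le _ _).trans ?_
      rw [abs_mul, abs_mul]
      gcongr
      · exact abs_area_le _ _
      · exact hg _ hx₁ _ hy₁
      · exact abs_area_le _ _
      · exact hg _ hx₂ _ hy₂
    rw [div_mul_eq_mul_div, div_mul_eq_mul_div, le_div_iff₀ hp]
    nlinarith [mul_nonneg hM (norm_nonneg z)]
  · push Not at h
    obtain ⟨x₁, hx₁, y₁, hy₁, hne⟩ := hX
    set p := x₁ - y₁
    have hp : 0 < ‖p‖ := norm_pos_iff.2 (sub_ne_zero.2 hne)
    refine ⟨‖p‖⁻¹, by positivity, fun g M hg x hx y hy => ?_⟩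
    have hM : 0 ≤ M := (abs_nonneg _).trans (hg x hx y hy)
    set z := x - y
    have h1 := norm_sq_smul_eq z p
    rw [h x₁ hx₁ y₁ hy₁ x hx y hy, zero_smul, add_zero] at h1
    have h2 : ‖p‖ ^ 2 * g z = (inner ℝ p z : ℝ) * g p := by simpa using congrArg g h1
    have h3 : ‖p‖ ^ 2 * |g z| ≤ (‖p‖ * ‖z‖) * M := by
      rw [← abs_of_nonneg (sq_nonneg ‖p‖), ← abs_mul, h2, abs_mul]
      gcongr
      · exact abs_real_inner_le_norm _ _
      · exact hg _ hx₁ _ hy₁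
    rw [mul_assoc, inv_mul_eq_div, le_div_iff₀ hp]
    refine le_of_mul_le_mul_left ?_ hp
    linarith

namespace PlanarAffineIFS

variable {N : ℕ} {F : PlanarAffineIFS N} {X : Set Plane}

theorem wordMap_append (u w : List (Fin N)) (x : Plane) :
    F.wordMap (u ++ w) x = F.wordMap u (F.wordMap w x) := by
  induction u with
  | nil => rfl
  | cons i u ih => exact congrArg (F.map i) ih

theorem map_sub_map (i : Fin N) (x y : Plane) : F.map i x - F.map i y = F.A i (x - y) := by
  simp [map]

theorem wordMap_sub (w : List (Fin N)) (x y : Plane) :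
    F.wordMap w x - F.wordMap w y = F.wordLinear w (x - y) := by
  induction w with
  | nil => rfl
  | cons i w ih =>
    change F.map i (F.wordMap w x) - F.map i (F.wordMap w y) = _
    rw [map_sub_map, ih, wordLinear_cons]
    rfl

theorem continuous_wordMap (w : List (Fin N)) : Continuous (F.wordMap w) := by
  have h : F.wordMap w = fun x => F.wordLinear w x + F.wordMap w 0 := by
    ext1 x
    have := F.wordMap_sub w x 0
    rw [sub_zero] at this
    rw [← this, sub_add_cancel]
  rw [h]
  fun_prop

theorem IsSelfAffineSet.map_mem (hX : F.IsSelfAffineSet X) (i : Fin N) {x : Plane}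
    (hx : x ∈ X) : F.map i x ∈ X := by
  rw [hX.2.2]
  exact Set.mem_iUnion.2 ⟨i, x, hx, rfl⟩

theorem IsSelfAffineSet.wordMap_mem (hX : F.IsSelfAffineSet X) (w : List (Fin N)) {x : Plane}
    (hx : x ∈ X) : F.wordMap w x ∈ X := by
  induction w with
  | nil => exact hx
  | cons i w ih => exact hX.map_mem i ih

theorem IsSelfAffineSet.exists_wordMap_eq (hX : F.IsSelfAffineSet X) (n : ℕ) :
    ∀ x ∈ X, ∃ u : List (Fin N), u.length = n ∧ ∃ y ∈ X, F.wordMap u y = x := by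
  induction n with
  | zero => exact fun x hx => ⟨[], rfl, x, hx, rfl⟩
  | succ n ih =>
    intro x hx
    rw [hX.2.2] at hx
    obtain ⟨i, y, hy, rfl⟩ := Set.mem_iUnion.1 hx
    obtain ⟨u, hu, z, hz, rfl⟩ := ih y hy
    exact ⟨i :: u, by simp [hu], z, hz, rfl⟩

variable (F) in
theorem exists_wordNorm_le_pow :
    ∃ ρ : ℝ, 0 ≤ ρ ∧ ρ < 1 ∧ ∀ w : List (Fin N), F.wordNorm w ≤ ρ ^ w.length := by
  obtain ⟨ρ, h0, h1, hρ⟩ : ∃ ρ : ℝ, 0 ≤ ρ ∧ ρ < 1 ∧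
      ∀ i, ‖(F.A i : Plane →L[ℝ] Plane)‖ ≤ ρ := by
    rcases isEmpty_or_nonempty (Fin N) with h | h
    · exact ⟨0, le_rfl, zero_lt_one, fun i => h.elim i⟩
    · obtain ⟨i, hi⟩ := Finite.exists_max fun i => ‖(F.A i : Plane →L[ℝ] Plane)‖
      exact ⟨_, norm_nonneg _, F.norm_lt_one i, hi⟩
  refine ⟨ρ, h0, h1, fun w => ?_⟩
  induction w with
  | nil => simpa using F.wordNorm_le_one []
  | cons i w ih =>
    rw [List.length_cons, pow_succ']
    refine (F.wordNorm_append_le [i] w).trans (mul_le_mul ?_ ih (F.wordNorm_pos w).le h0)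
    simpa [wordNorm, wordLinear] using hρ i

variable (F) in
theorem exists_le_wordNorm (n : ℕ) :
    ∃ β : ℝ, 0 < β ∧ ∀ w : List (Fin N), w.length = n → β ≤ F.wordNorm w := by
  obtain ⟨B, hB⟩ := ((List.finite_length_eq (Fin N) n).image fun w => (F.wordNorm w)⁻¹).bddAbove
  refine ⟨(max 1 B)⁻¹, by positivity, fun w hw => ?_⟩
  rw [inv_le_comm₀ (by positivity) (F.wordNorm_pos w)]
  exact (hB ⟨w, hw, rfl⟩).trans (le_max_right _ _)

/-- Common first letters cancel by injectivity, and distinct first letters are handled by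
separation. If one word runs out, the other is a strict contraction and cannot fix two points. -/
theorem IsSelfAffineSet.wordMap_ne (hX : F.IsSelfAffineSet X) (hsep : F.StrongSeparation X)
    (hnt : X.Nontrivial) : ∀ i j : List (Fin N), i ≠ j →
      ∃ x ∈ X, F.wordMap i x ≠ F.wordMap j x := by
  have key : ∀ i : List (Fin N), i ≠ [] → ∃ x ∈ X, F.wordMap i x ≠ x := by
    intro i hi
    by_contra! hfix
    obtain ⟨x, hx, y, hy, hxy⟩ := hnt
    obtain ⟨ρ, h0, h1, hρ⟩ := F.exists_wordNorm_le_pow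
    have h2 := F.wordMap_sub i x y
    rw [hfix x hx, hfix y hy] at h2
    have h3 : ‖x - y‖ ≤ F.wordNorm i * ‖x - y‖ := by
      conv_lhs => rw [h2]
      exact le_opNorm_apply _ _
    have h4 : F.wordNorm i < 1 :=
      (hρ i).trans_lt (pow_lt_one₀ h0 h1 (by simpa using hi))
    have h5 : 0 < ‖x - y‖ := norm_pos_iff.2 (sub_ne_zero.2 hxy)
    nlinarith
  intro i
  induction i with
  | nil =>
    intro j hj
    obtain ⟨x, hx, h⟩ := key j hj.symm
    exact ⟨x, hx, h.symm⟩
  | cons a i ih =>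
    intro j hj
    match j with
    | [] => exact key _ hj
    | b :: j =>
      by_cases hab : a = b
      · subst hab
        obtain ⟨x, hx, h⟩ := ih j (by simpa using hj)
        refine ⟨x, hx, fun he => h ?_⟩
        have h1 := F.map_sub_map a (F.wordMap i x) (F.wordMap j x)
        rw [sub_eq_zero.2 (show F.map a (F.wordMap i x) = F.map a (F.wordMap j x) from he)] at h1
        exact sub_eq_zero.1 ((map_eq_zero_iff _ (F.A a).injective).1 h1.symm)
      · obtain ⟨x, hx⟩ := hX.1
        refine ⟨x, hx, fun he => Set.disjoint_left.1 (hsep hab)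
          ⟨_, hX.wordMap_mem i hx, rfl⟩ ⟨_, hX.wordMap_mem j hx, he.symm⟩⟩

theorem norm_mul_norm_projPerp (V : ℙ ℝ Plane) {v : Plane} (hv : v ≠ 0) (hvV : v ∈ V.submodule)
    (z : Plane) : ‖v‖ * ‖projPerp V z‖ = |area v z| := by
  have hspan := submodule_eq_span_singleton hv hvV
  set p := projPerp V z with hp
  have hmem : p ∈ V.submoduleᗮ := Submodule.starProjection_apply_mem _ _
  have hin : (inner ℝ v p : ℝ) = 0 := Submodule.inner_right_of_mem_orthogonal hvV hmem
  have hdiff : z - p ∈ V.submodule := by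
    have h := Submodule.sub_starProjection_mem_orthogonal (K := V.submoduleᗮ) z
    rwa [Submodule.orthogonal_orthogonal] at h
  rw [hspan] at hdiff
  obtain ⟨c, hc⟩ := Submodule.mem_span_singleton.1 hdiff
  have h1 : area v z = area v p := by
    rw [← sub_eq_zero, ← area_sub_right, ← hc, area_smul_right, area_self, mul_zero]
  have h2 := area_sq_add_inner_sq v p
  rw [hin] at h2
  rw [h1, ← sq_eq_sq₀ (by positivity) (abs_nonneg _), sq_abs, mul_pow]
  linarith

theorem nontrivial_of_not_projectiveOpenSetCondition
    (hX : F.IsSelfAffineSet X) (hposc : ¬ F.ProjectiveOpenSetCondition X) : X.Nontrivial := by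
  by_contra hnt
  rw [Set.not_nontrivial_iff] at hnt
  obtain ⟨x, hx⟩ := hX.1
  refine hposc ⟨1, one_pos, fun V _ i j _ => ⟨x, hx, ?_⟩⟩
  rw [Metric.diam_subsingleton ((hnt.image _).image _), mul_zero]
  exact norm_nonneg _

/-- Failure of the projective open set condition in terms of the area form. -/
theorem exists_abs_area_le_of_not_projectiveOpenSetCondition
    (hX : F.IsSelfAffineSet X) (hposc : ¬ F.ProjectiveOpenSetCondition X) {η : ℝ} (hη : 0 < η) :
    ∃ v ∈ F.furstenbergVectors, ∃ i j : List (Fin N), i ≠ j ∧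
      ∀ x ∈ X, |area v (F.wordMap i x - F.wordMap j x)| ≤ η * F.width i v := by
  have hbd := hX.2.1.isBounded
  have hd : 0 ≤ Metric.diam X := Metric.diam_nonneg
  by_contra! hno
  -- The projected cylinder has diameter at most `width * diam X / ‖v‖`; the added one keeps the
  -- denominator positive.
  refine hposc ⟨η / (Metric.diam X + 1), by positivity, fun V hV i j hij => ?_⟩
  have hvV : V.rep ∈ V.submodule := by
    rw [Projectivization.submodule_eq]; exact Submodule.mem_span_singleton_self _
  obtain ⟨x, hx, h⟩ := hno V.rep ⟨V.rep_nonzero, V, hV, hvV⟩ i j hij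
  refine ⟨x, hx, ?_⟩
  set v := V.rep
  have hvp : 0 < ‖v‖ := norm_pos_iff.2 V.rep_nonzero
  have hw := F.width_pos i V.rep_nonzero
  rw [← map_sub]
  have hdiam : Metric.diam (projPerp V '' (F.wordMap i '' X)) ≤
      F.width i v * Metric.diam X / ‖v‖ := by
    refine Metric.diam_le_of_forall_dist_le (by positivity) ?_
    rintro _ ⟨_, ⟨a, ha, rfl⟩, rfl⟩ _ ⟨_, ⟨b, hb, rfl⟩, rfl⟩
    rw [dist_eq_norm, ← map_sub, wordMap_sub, le_div_iff₀' hvp,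
      norm_mul_norm_projPerp V V.rep_nonzero hvV]
    refine (F.abs_area_wordLinear_le i v (a - b)).trans ?_
    gcongr
    rw [← dist_eq_norm]
    exact Metric.dist_le_diam_of_mem hbd ha hb
  rw [← norm_mul_norm_projPerp V V.rep_nonzero hvV] at h
  refine le_of_mul_le_mul_left ?_ hvp
  refine le_trans ?_ h.le
  calc ‖v‖ * (η / (Metric.diam X + 1) * Metric.diam (projPerp V '' (F.wordMap i '' X)))
      ≤ ‖v‖ * (η / (Metric.diam X + 1) * (F.width i v * Metric.diam X / ‖v‖)) := by gcongr
    _ = η * F.width i v * (Metric.diam X / (Metric.diam X + 1)) := by field_simp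
    _ ≤ η * F.width i v * 1 := by
      gcongr
      rw [div_le_one (by positivity)]; linarith
    _ = _ := mul_one _

/-- After the prefix `i` the direction is still Furstenberg, so the inverse of `t` expands it at
full rate. The reverse estimate `width_append_le` needs no domination. -/
theorem IsDominated.exists_le_width (h : F.IsDominated) :
    ∃ κ : ℝ, 0 < κ ∧ ∀ v ∈ F.furstenbergVectors, ∀ i t : List (Fin N),
      κ * F.wordNorm t * F.width i v ≤ F.width (i ++ t) v := by
  obtain ⟨κ, hκ, hexp⟩ := h.exists_le_norm_symm_apply
  refine ⟨κ, hκ, fun v hv i t => ?_⟩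
  rw [width_append, width, width, wordNorm, opNorm_eq_abs_planeDet_mul]
  have h1 := hexp _ (F.symm_mem_furstenbergVectors hv i) t
  calc _ = |planeDet (F.wordLinear i)| * (|planeDet (F.wordLinear t)| *
        (κ * (‖((F.wordLinear t).symm : Plane →L[ℝ] Plane)‖ *
          ‖(F.wordLinear i).symm v‖))) := by ring
    _ ≤ _ := by gcongr

variable (F) in
theorem width_append_le (i t : List (Fin N)) (v : Plane) :
    F.width (i ++ t) v ≤ F.wordNorm t * F.width i v := by
  rw [width_append]
  calc _ ≤ |planeDet (F.wordLinear i)| * (F.wordNorm t * ‖(F.wordLinear i).symm v‖) := by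
        gcongr
        exact F.width_le t _
    _ = _ := by rw [width]; ring

/-! ### Displacements of prescribed relative size -/

variable (F) in
/-- The maps along `i` and `j`, viewed transversally to `v`, are displaced from each other in a
fixed sense by between `a` and `b` times the width of the image of the map along `i`. -/
def Displaces (X : Set Plane) (i j : List (Fin N)) (a b : ℝ) (v : Plane) : Prop :=
  ∃ σ : ℝ, (σ = 1 ∨ σ = -1) ∧ ∀ x ∈ X,
    a * F.width i v ≤ σ * area v (F.wordMap i x - F.wordMap j x) ∧
    σ * area v (F.wordMap i x - F.wordMap j x) ≤ b * F.width i v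

theorem exists_sign_mul_abs (c : ℝ) : ∃ σ : ℝ, (σ = 1 ∨ σ = -1) ∧ σ * c = |c| := by
  rcases le_total 0 c with h | h
  · exact ⟨1, Or.inl rfl, by rw [abs_of_nonneg h, one_mul]⟩
  · exact ⟨-1, Or.inr rfl, by rw [abs_of_nonpos h, neg_one_mul]⟩

theorem sign_mul_sign {σ τ : ℝ} (hσ : σ = 1 ∨ σ = -1) (hτ : τ = 1 ∨ τ = -1) :
    σ * τ = 1 ∨ σ * τ = -1 := by
  rcases hσ with rfl | rfl <;> rcases hτ with rfl | rfl <;> simp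

theorem Displaces.of_smul {i j : List (Fin N)} {a b c : ℝ} {v : Plane} (hc : c ≠ 0)
    (h : F.Displaces X i j a b (c • v)) : F.Displaces X i j a b v := by
  obtain ⟨σ, hσ, h⟩ := h
  obtain ⟨τ, hτ, hτc⟩ := exists_sign_mul_abs c
  have hcp := abs_pos.2 hc
  refine ⟨σ * τ, sign_mul_sign hσ hτ, fun x hx => ?_⟩
  have h1 := h x hx
  rw [width_smul, area_smul_left] at h1
  have hττ : τ * τ = 1 := by rcases hτ with rfl | rfl <;> norm_num
  have hc' : c = τ * |c| := by rw [← hτc, ← mul_assoc, hττ, one_mul]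
  constructor
  · refine le_of_mul_le_mul_left ?_ hcp
    calc |c| * (a * F.width i v) = a * (|c| * F.width i v) := by ring
      _ ≤ σ * (c * area v (F.wordMap i x - F.wordMap j x)) := h1.1
      _ = _ := by conv_lhs => rw [hc']
                  ring
  · refine le_of_mul_le_mul_left ?_ hcp
    calc _ = σ * (c * area v (F.wordMap i x - F.wordMap j x)) := by
            conv_rhs => rw [hc']
            ring
      _ ≤ b * (|c| * F.width i v) := h1.2
      _ = _ := by ring

theorem Displaces.append_left {i j : List (Fin N)} {a b : ℝ} {v : Plane} (u : List (Fin N))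
    (h : F.Displaces X i j a b ((F.wordLinear u).symm v)) :
    F.Displaces X (u ++ i) (u ++ j) a b v := by
  obtain ⟨σ, hσ, h⟩ := h
  obtain ⟨τ, hτ, hτc⟩ := exists_sign_mul_abs (planeDet (F.wordLinear u))
  refine ⟨σ * τ, sign_mul_sign hσ hτ, fun x hx => ?_⟩
  have h1 := h x hx
  have h2 : σ * τ * area v (F.wordMap (u ++ i) x - F.wordMap (u ++ j) x) =
      |planeDet (F.wordLinear u)| *
        (σ * area ((F.wordLinear u).symm v) (F.wordMap i x - F.wordMap j x)) := by
    rw [wordMap_append, wordMap_append, wordMap_sub, area_apply_right, ← hτc]; ring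
  rw [h2, width_append, mul_left_comm, mul_left_comm b]
  exact ⟨mul_le_mul_of_nonneg_left h1.1 (abs_nonneg _),
    mul_le_mul_of_nonneg_left h1.2 (abs_nonneg _)⟩

theorem IsSelfAffineSet.exists_norm_wordMap_sub_le (hX : F.IsSelfAffineSet X)
    (i j : List (Fin N)) :
    ∃ L : ℝ, 0 < L ∧ ∀ x ∈ X, ‖F.wordMap i x - F.wordMap j x‖ ≤ L := by
  obtain ⟨L, hL⟩ := hX.2.1.exists_bound_of_continuousOn
    (f := fun x => F.wordMap i x - F.wordMap j x)
    ((F.continuous_wordMap i).sub (F.continuous_wordMap j)).continuousOn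
  exact ⟨max 1 L, by positivity, fun x hx => (hL x hx).trans (le_max_right _ _)⟩

/-- The displacement is linear in the direction, uniformly over the compact `X`, and the width is
continuous and positive; halving and doubling the bounds leaves room. -/
theorem Displaces.eventually (hX : F.IsSelfAffineSet X) {i j : List (Fin N)} {a b : ℝ}
    {v : Plane} (hv : v ≠ 0) (ha : 0 < a) (hb : 0 < b) (h : F.Displaces X i j a b v) :
    ∀ᶠ v' in 𝓝 v, F.Displaces X i j (a / 2) (2 * b) v' := by
  obtain ⟨σ, hσ, h⟩ := h
  obtain ⟨L, hL, hLb⟩ := hX.exists_norm_wordMap_sub_le i j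
  have hw := F.width_pos i hv
  have hcw := F.continuous_width i
  have e1 : ∀ᶠ v' in 𝓝 v, a / 2 * F.width i v' + L * ‖v' - v‖ < a * F.width i v := by
    have hc : Continuous fun v' => a / 2 * F.width i v' + L * ‖v' - v‖ := by fun_prop
    refine hc.continuousAt.eventually (gt_mem_nhds ?_)
    simp only [sub_self, norm_zero, mul_zero, add_zero]
    nlinarith
  have e2 : ∀ᶠ v' in 𝓝 v, L * ‖v' - v‖ - 2 * b * F.width i v' < -(b * F.width i v) := by
    have hc : Continuous fun v' => L * ‖v' - v‖ - 2 * b * F.width i v' := by fun_prop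
    refine hc.continuousAt.eventually (gt_mem_nhds ?_)
    simp only [sub_self, norm_zero, mul_zero]
    nlinarith
  filter_upwards [e1, e2] with v' h1 h2
  refine ⟨σ, hσ, fun x hx => ?_⟩
  have h3 := h x hx
  have h4 : |σ * area v' (F.wordMap i x - F.wordMap j x) -
      σ * area v (F.wordMap i x - F.wordMap j x)| ≤ L * ‖v' - v‖ := by
    rw [← mul_sub, ← area_sub_left, abs_mul]
    have : |σ| = 1 := by rcases hσ with rfl | rfl <;> simp
    rw [this, one_mul, mul_comm L]
    exact (abs_area_le _ _).trans (by gcongr; exact hLb x hx)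
  rw [abs_le] at h4
  constructor <;> linarith

/-- Arbitrarily small displacements occur at some Furstenberg direction. -/
theorem exists_displaces_at (hX : F.IsSelfAffineSet X) (hdom : F.IsDominated)
    (hsep : F.StrongSeparation X) (hposc : ¬ F.ProjectiveOpenSetCondition X)
    (hXF : ¬ ∃ V, F.furstenbergDirections = {V}) {ε : ℝ} (hε : 0 < ε) :
    ∃ a : ℝ, 0 < a ∧ a ≤ ε ∧ ∃ i j : List (Fin N), ∃ v ∈ F.furstenbergVectors,
      F.Displaces X i j a (2 * a) v := by
  have hnt := nontrivial_of_not_projectiveOpenSetCondition hX hposc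
  obtain ⟨C, hC, hLip⟩ := exists_lipschitz_of_bounded hnt
  obtain ⟨κ, hκ, hwid⟩ := hdom.exists_le_width
  have hbd := hX.2.1.isBounded
  -- The depth `n` depends on `X` alone and not on the word pair, so the width lost on a subcylinder
  -- can be built into `η`.
  obtain ⟨n, hn⟩ : ∃ n : ℕ, ∀ u : List (Fin N), u.length = n →
      F.wordNorm u * Metric.diam X ≤ 1 / (4 * C) := by
    obtain ⟨ρ, h0, h1, hρ⟩ := F.exists_wordNorm_le_pow
    have ht : Filter.Tendsto (fun n : ℕ => ρ ^ n * Metric.diam X) Filter.atTop (𝓝 0) := by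
      simpa using (tendsto_pow_atTop_nhds_zero_of_lt_one h0 h1).mul_const (Metric.diam X)
    obtain ⟨n, hn⟩ := (ht.eventually (gt_mem_nhds (show (0 : ℝ) < 1 / (4 * C) by positivity))).exists
    refine ⟨n, fun u hu => le_trans ?_ hn.le⟩
    rw [← hu]
    exact mul_le_mul_of_nonneg_right (hρ u) Metric.diam_nonneg
  obtain ⟨β, hβ, hβn⟩ := F.exists_le_wordNorm n
  set η := ε * κ * β with hη
  have hη0 : 0 < η := by positivity
  obtain ⟨v, hv, i, j, hij, hsmall⟩ :=
    exists_abs_area_le_of_not_projectiveOpenSetCondition hX hposc hη0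
  obtain ⟨x₁, hx₁, hne⟩ := hX.wordMap_ne hsep hnt i j hij
  obtain ⟨L, hL, hLb⟩ := hX.exists_norm_wordMap_sub_le i j
  have hw := F.width_pos i hv.1
  have hcw := F.continuous_width i
  have e1 : ∀ᶠ v' in 𝓝 v, L * ‖v' - v‖ - 2 * η * F.width i v' < -(η * F.width i v) := by
    have hc : Continuous fun v' => L * ‖v' - v‖ - 2 * η * F.width i v' := by fun_prop
    refine hc.continuousAt.eventually (gt_mem_nhds ?_)
    simp only [sub_self, norm_zero, mul_zero]
    nlinarith
  -- At `v` the displacement may vanish identically; a nearby Furstenberg direction makes it nonzero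
  -- at `x₁`.
  obtain ⟨w, hwS, hwU, hwne⟩ := hdom.exists_mem_area_ne_zero hXF hv e1 (sub_ne_zero.2 hne)
  set d : Plane → ℝ := fun x => area w (F.wordMap i x - F.wordMap j x) with hd
  have hdle : ∀ x ∈ X, |d x| ≤ 2 * η * F.width i w := by
    intro x hx
    have h1 : d x = area v (F.wordMap i x - F.wordMap j x) +
        area (w - v) (F.wordMap i x - F.wordMap j x) := by
      rw [area_sub_left]; ring
    have h2 : |area (w - v) (F.wordMap i x - F.wordMap j x)| ≤ L * ‖w - v‖ := by
      rw [mul_comm L]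
      exact (abs_area_le _ _).trans (by gcongr; exact hLb x hx)
    rw [h1]
    refine (abs_add_le _ _).trans ?_
    have h3 := hsmall x hx
    have h4 : L * ‖w - v‖ - 2 * η * F.width i w < -(η * F.width i v) := hwU
    linarith
  have hdc : Continuous d := by
    have h1 := F.continuous_wordMap i
    have h2 := F.continuous_wordMap j
    simp only [hd, area]
    fun_prop
  obtain ⟨x₀, hx₀, hmax⟩ := hX.2.1.exists_isMaxOn hX.1 (f := fun x => |d x|)
    hdc.abs.continuousOn
  have hmax' : ∀ x ∈ X, |d x| ≤ |d x₀| := fun x hx => hmax hx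
  set M := |d x₀| with hM
  have hM0 : 0 < M := (abs_pos.2 hwne).trans_le (hmax' x₁ hx₁)
  obtain ⟨u, hu, y₀, hy₀, hy₀x⟩ := hX.exists_wordMap_eq n x₀ hx₀
  obtain ⟨σ, hσ, hσd⟩ := exists_sign_mul_abs (d x₀)
  have hσ1 : |σ| = 1 := by rcases hσ with rfl | rfl <;> simp
  set g : Plane →ₗ[ℝ] ℝ :=
    { toFun := fun z => area w (F.wordLinear i z - F.wordLinear j z)
      map_add' := fun a b => by
        rw [map_add, map_add, add_sub_add_comm, area_add_right]
      map_smul' := fun c a => by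
        rw [map_smul, map_smul, ← smul_sub, area_smul_right]; rfl } with hg
  have hgd : ∀ x y, g (x - y) = d x - d y := by
    intro x y
    change area w (F.wordLinear i (x - y) - F.wordLinear j (x - y)) = _
    rw [← wordMap_sub, ← wordMap_sub, ← area_sub_right]
    congr 1
    abel
  -- The displacement is affine with linear part `g`, bounded by `2 * M` on differences. On the
  -- depth `n` cylinder around its maximum it thus varies by at most half that maximum.
  have hvar : ∀ y ∈ X, |d (F.wordMap u y) - d x₀| ≤ M / 2 := by
    intro y hy
    have h1 := hLip g (2 * M) (fun x hx y hy => by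
      rw [hgd]
      refine (abs_sub _ _).trans ?_
      linarith [hmax' x hx, hmax' y hy]) _ (hX.wordMap_mem u hy) _ hx₀
    rw [hgd] at h1
    have h2 : ‖F.wordMap u y - x₀‖ ≤ 1 / (4 * C) := by
      rw [← hy₀x, wordMap_sub]
      refine (le_opNorm_apply _ _).trans (le_trans ?_ (hn u hu))
      rw [← dist_eq_norm]
      exact mul_le_mul_of_nonneg_left (Metric.dist_le_diam_of_mem hbd hy hy₀) (norm_nonneg _)
    refine h1.trans ?_
    calc _ ≤ C * (2 * M) * (1 / (4 * C)) := by gcongr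
      _ = _ := by field_simp; ring
  have hwi := F.width_pos i hwS.1
  have hwiu := F.width_pos (i ++ u) hwS.1
  refine ⟨M / (2 * F.width (i ++ u) w), by positivity, ?_, i ++ u, j ++ u, w, hwS, σ, hσ,
    fun y hy => ?_⟩
  · rw [div_le_iff₀ (by positivity)]
    have h1 := hwid w hwS i u
    have h2 := hdle x₀ hx₀
    have h3 : κ * β * F.width i w ≤ κ * F.wordNorm u * F.width i w := by
      gcongr
      exact hβn u hu
    calc M ≤ 2 * η * F.width i w := h2
      _ = ε * (2 * (κ * β * F.width i w)) := by rw [hη]; ring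
      _ ≤ _ := by
        gcongr
        exact h3.trans h1
  · rw [wordMap_append, wordMap_append]
    change _ ≤ σ * d (F.wordMap u y) ∧ σ * d (F.wordMap u y) ≤ _
    have h1 : |σ * d (F.wordMap u y) - M| ≤ M / 2 := by
      rw [show σ * d (F.wordMap u y) - M = σ * (d (F.wordMap u y) - d x₀) by rw [mul_sub, hσd],
        abs_mul, hσ1, one_mul]
      exact hvar y hy
    have h2 : σ * d (F.wordMap u y) ≤ M := by
      refine (le_abs_self _).trans ?_
      rw [abs_mul, hσ1, one_mul]
      exact hmax' _ (hX.wordMap_mem u hy)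
    have h3 : M / (2 * F.width (i ++ u) w) * F.width (i ++ u) w = M / 2 := by field_simp
    rw [abs_le] at h1
    constructor <;> nlinarith

/-- Displacements of every prescribed size occur, uniformly over the Furstenberg directions. -/
theorem exists_displaces (hX : F.IsSelfAffineSet X) (hdom : F.IsDominated)
    (hsep : F.StrongSeparation X) (hposc : ¬ F.ProjectiveOpenSetCondition X)
    (hXF : ¬ ∃ V, F.furstenbergDirections = {V}) :
    ∃ c : ℝ, 0 < c ∧ ∀ a : ℝ, 0 < a → ∃ i j : List (Fin N), ∀ v ∈ F.furstenbergVectors,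
      F.Displaces X i j a (c * a) v := by
  obtain ⟨κ, hκ, hwid⟩ := hdom.exists_le_width
  obtain ⟨l⟩ : Nonempty (Fin N) := by
    obtain ⟨x, hx⟩ := hX.1
    rw [hX.2.2] at hx
    exact ⟨(Set.mem_iUnion.1 hx).choose⟩
  set m : ℝ := ‖((F.A l).symm : Plane →L[ℝ] Plane)‖
  have hm : 0 < m := opNorm_pos (F.A l).symm
  refine ⟨8 * m / κ, by positivity, fun a ha => ?_⟩
  obtain ⟨a', ha', ha'a, i, j, v₀, hv₀, hdis⟩ := exists_displaces_at hX hdom hsep hposc hXF ha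
  -- The prefix `u` brings every Furstenberg direction into the neighbourhood where the displacement
  -- estimate persists.
  obtain ⟨u, hu⟩ := hdom.exists_smul_symm_mem hv₀
    (hdis.eventually hX hv₀.1 ha' (by positivity))
  have hall : ∀ v ∈ F.furstenbergVectors,
      F.Displaces X (u ++ i) (u ++ j) (a' / 2) (2 * (2 * a')) v := by
    intro v hv
    obtain ⟨c, hc, hcv⟩ := hu v hv
    exact (Displaces.of_smul hc hcv).append_left u
  -- a power of the letter `l` with norm close to `a' / (2 * a)`
  set y := a' / 2 / a with hy
  have hy0 : 0 < y := by positivity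
  obtain ⟨t, ht1, ht2⟩ : ∃ t : List (Fin N), F.wordNorm t ≤ y ∧ y < m * F.wordNorm t := by
    obtain ⟨ρ, h0, h1, hρ⟩ := F.exists_wordNorm_le_pow
    have hex : ∃ n : ℕ, F.wordNorm (List.replicate n l) ≤ y := by
      obtain ⟨n, hn⟩ := exists_pow_lt_of_lt_one hy0 h1
      exact ⟨n, by simpa using (hρ (List.replicate n l)).trans (by simpa using hn.le)⟩
    classical
    have hspec := Nat.find_spec hex
    have hmin := fun k => @Nat.find_min _ _ hex k
    rcases hk : Nat.find hex with _ | k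
    · rw [hk] at hspec
      have h2 : F.wordNorm (List.replicate 0 l) = 1 :=
        ContinuousLinearMap.norm_id (𝕜 := ℝ) (E := Plane)
      have : a' / 2 / a < 1 := by
        rw [div_lt_one ha]; linarith
      linarith
    · rw [hk] at hspec
      refine ⟨_, hspec, (not_le.1 (hmin k (by omega))).trans_le ?_⟩
      have := opNorm_le_opNorm_mul (F.A l) (F.wordLinear (List.replicate k l))
      rw [← wordLinear_cons] at this
      exact this
  -- A common suffix keeps the displacement within its old bounds but shrinks the width by about
  -- `y`, raising the relative size from `a' / 2` to about `a`.
  refine ⟨u ++ i ++ t, u ++ j ++ t, fun v hv => ?_⟩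
  obtain ⟨σ, hσ, h⟩ := hall v hv
  refine ⟨σ, hσ, fun x hx => ?_⟩
  have h1 := h _ (hX.wordMap_mem t hx)
  rw [← wordMap_append, ← wordMap_append] at h1
  have h2 := hwid v hv (u ++ i) t
  have h3 := F.width_append_le (u ++ i) t v
  have hw := F.width_pos (u ++ i) hv.1
  have hay : a * y = a' / 2 := by rw [hy]; field_simp
  refine ⟨le_trans ?_ h1.1, h1.2.trans ?_⟩
  · calc _ ≤ a * (y * F.width (u ++ i) v) := by
          gcongr
          exact h3.trans (by gcongr)
      _ = _ := by rw [← hay]; ring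
  · calc _ = 8 * a * y * F.width (u ++ i) v := by linear_combination (-8 * F.width (u ++ i) v) * hay
      _ ≤ 8 * a * (m * F.wordNorm t) * F.width (u ++ i) v := by gcongr
      _ = 8 * m / κ * a * (κ * F.wordNorm t * F.width (u ++ i) v) := by field_simp
      _ ≤ _ := by gcongr

end PlanarAffineIFS

/-! ### Assouad dimension and chains of points -/

/-- A set that contains, for every `m`, a family of `m + 1` points separated by some `G` and of
diameter comparable to `m * G` has Assouad dimension at least one. -/
theorem one_le_assouadDim {α : Type*} [PseudoMetricSpace α] {X : Set α} {b : ℝ} (hb : 1 ≤ b)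
    (h : ∀ m : ℕ, ∃ G : ℝ, 0 < G ∧ ∃ p : ℕ → α, (∀ k ≤ m, p k ∈ X) ∧
      (∀ k ≤ m, ∀ l ≤ m, k ≠ l → G ≤ dist (p k) (p l)) ∧
      ∀ k ≤ m, dist (p k) (p 0) ≤ b * (m + 1) * G) : 1 ≤ assouadDim X := by
  refine le_iInf₂ fun s ⟨C, hC, hs⟩ => ?_
  by_contra! hlt
  have hs1 : (s : ℝ) < 1 := by exact_mod_cast hlt
  have key : ∀ m : ℕ, ((m : ℝ) + 1) ^ (1 - (s : ℝ)) ≤ C * (3 * b) ^ (s : ℝ) := by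
    intro m
    obtain ⟨G, hG, p, hpX, hsep, hdist⟩ := h m
    have hm : (1 : ℝ) ≤ (m : ℝ) + 1 := by simp
    have hbm : 1 ≤ b * ((m : ℝ) + 1) := one_le_mul_of_one_le_of_one_le hb hm
    -- A ball of radius `G / 3` contains at most one of the points. Hence `m + 1` is at most a
    -- constant times `(m + 1) ^ s`, impossible for large `m` if `s < 1`.
    obtain ⟨t, -, hcard, hcov⟩ := hs (p 0) (hpX 0 (Nat.zero_le m)) (G / 3)
      (b * ((m : ℝ) + 1) * G) (by positivity) (by nlinarith)
    have hex : ∀ k ∈ Finset.range (m + 1), ∃ y ∈ t, dist (p k) y ≤ G / 3 := by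
      intro k hk
      have hk' : k ≤ m := Nat.lt_succ_iff.1 (Finset.mem_range.1 hk)
      have := hcov ⟨hpX k hk', Metric.mem_closedBall.2 (hdist k hk')⟩
      simpa using this
    have : Nonempty α := ⟨p 0⟩
    choose! q hq hqd using hex
    have hinj : Set.InjOn q (Finset.range (m + 1) : Set ℕ) := by
      intro k hk l hl hkl
      rw [Finset.mem_coe] at hk hl
      by_contra hne
      have h1 := hqd k hk
      have h2 := hqd l hl
      rw [← hkl] at h2
      have h3 := hsep k (Nat.lt_succ_iff.1 (Finset.mem_range.1 hk)) l
        (Nat.lt_succ_iff.1 (Finset.mem_range.1 hl)) hne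
      have h4 := dist_triangle_right (p k) (p l) (q k)
      linarith
    have hle := Finset.card_le_card_of_injOn q hq hinj
    rw [Finset.card_range] at hle
    have hle' : (m : ℝ) + 1 ≤ C * (b * ((m : ℝ) + 1) * G / (G / 3)) ^ (s : ℝ) :=
      le_trans (by exact_mod_cast hle) hcard
    have hR : b * ((m : ℝ) + 1) * G / (G / 3) = (3 * b) * ((m : ℝ) + 1) := by field_simp
    rw [hR, Real.mul_rpow (by positivity) (by positivity)] at hle'
    have hpos : 0 < ((m : ℝ) + 1) ^ (s : ℝ) := by positivity
    rw [Real.rpow_sub (by positivity), Real.rpow_one, div_le_iff₀ hpos]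
    linarith
  have ht : Filter.Tendsto (fun m : ℕ => ((m : ℝ) + 1) ^ (1 - (s : ℝ))) Filter.atTop
      Filter.atTop :=
    (tendsto_rpow_atTop (by linarith)).comp
      (Filter.tendsto_atTop_add_const_right _ 1 tendsto_natCast_atTop_atTop)
  obtain ⟨m, hm⟩ := (ht.eventually (Filter.eventually_gt_atTop (C * (3 * b) ^ (s : ℝ)))).exists
  exact absurd (key m) (not_le.2 hm)

theorem sub_bounds_of_succ_sub_bounds {f : ℕ → ℝ} {D E : ℝ} {m : ℕ}
    (h : ∀ k < m, D ≤ f (k + 1) - f k ∧ f (k + 1) - f k ≤ E) {k l : ℕ} (hkl : k ≤ l)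
    (hl : l ≤ m) : ((l : ℝ) - k) * D ≤ f l - f k ∧ f l - f k ≤ ((l : ℝ) - k) * E := by
  induction l, hkl using Nat.le_induction with
  | base => simp
  | succ l hkl ih =>
    have h1 := ih (by omega)
    have h2 := h l (by omega)
    push_cast
    constructor <;> linarith

namespace PlanarAffineIFS

variable {N : ℕ} {F : PlanarAffineIFS N} {X : Set Plane}

/-- Transversally to every Furstenberg direction, the set contains arbitrarily long chains of points
with comparable gaps. -/
theorem exists_chain (hX : F.IsSelfAffineSet X) (hdom : F.IsDominated)
    (hsep : F.StrongSeparation X) (hposc : ¬ F.ProjectiveOpenSetCondition X)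
    (hXF : ¬ ∃ V, F.furstenbergDirections = {V}) :
    ∃ c : ℝ, 0 < c ∧ ∀ m : ℕ, ∃ J : List (Fin N), ∀ v ∈ F.furstenbergVectors,
      ∃ x : ℕ → Plane, (∀ k ≤ m, x k ∈ X) ∧
        ∀ k < m, F.width J v ≤ area v (x (k + 1)) - area v (x k) ∧
          area v (x (k + 1)) - area v (x k) ≤ c * F.width J v := by
  obtain ⟨c₀, hc₀, hdis⟩ := exists_displaces hX hdom hsep hposc hXF
  obtain ⟨κ, hκ, hwid⟩ := hdom.exists_le_width
  refine ⟨c₀ / κ, by positivity, fun m => ?_⟩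
  induction m with
  | zero =>
    obtain ⟨x, hx⟩ := hX.1
    exact ⟨[], fun v _ => ⟨fun _ => x, fun _ _ => hx, fun k hk => absurd hk (Nat.not_lt_zero k)⟩⟩
  | succ m ih =>
    obtain ⟨J, hJ⟩ := ih
    -- This size makes the displacement comparable to the width of `i ++ J`, which is the gap scale
    -- of the old chain after applying the map along `i`.
    obtain ⟨i, j, hij⟩ := hdis (F.wordNorm J) (F.wordNorm_pos J)
    refine ⟨i ++ J, fun v hv => ?_⟩
    -- The sign `τ` compensates for an orientation reversal, so that the image chain is still
    -- increasing.
    obtain ⟨τ, hτ, hτd⟩ := exists_sign_mul_abs (planeDet (F.wordLinear i))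
    have hτ0 : τ ≠ 0 := by rcases hτ with rfl | rfl <;> norm_num
    have hττ : τ * τ = 1 := by rcases hτ with rfl | rfl <;> norm_num
    have hτ1 : |τ| = 1 := by rcases hτ with rfl | rfl <;> simp
    obtain ⟨x, hxX, hx⟩ := hJ _
      (F.smul_mem_furstenbergVectors (F.symm_mem_furstenbergVectors hv i) hτ0)
    have hinner : ∀ k < m,
        F.width (i ++ J) v ≤
          area v (F.wordMap i (x (k + 1))) - area v (F.wordMap i (x k)) ∧
        area v (F.wordMap i (x (k + 1))) - area v (F.wordMap i (x k)) ≤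
          c₀ / κ * F.width (i ++ J) v := by
      intro k hk
      have h1 := hx k hk
      have h2 : area v (F.wordMap i (x (k + 1))) - area v (F.wordMap i (x k)) =
          |planeDet (F.wordLinear i)| * (area (τ • (F.wordLinear i).symm v) (x (k + 1)) -
            area (τ • (F.wordLinear i).symm v) (x k)) := by
        rw [← area_sub_right, wordMap_sub, area_apply_right, ← hτd, ← area_sub_right,
          area_smul_left]
        linear_combination (-planeDet (F.wordLinear i) *
          area ((F.wordLinear i).symm v) (x (k + 1) - x k)) * hττ
      rw [width_smul, hτ1, one_mul] at h1
      rw [h2, width_append, mul_left_comm (c₀ / κ)]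
      exact ⟨mul_le_mul_of_nonneg_left h1.1 (abs_nonneg _),
        mul_le_mul_of_nonneg_left h1.2 (abs_nonneg _)⟩
    obtain ⟨σ, hσ, hd⟩ := hij v hv
    have hdisp : ∀ y ∈ X,
        F.width (i ++ J) v ≤ σ * (area v (F.wordMap i y) - area v (F.wordMap j y)) ∧
        σ * (area v (F.wordMap i y) - area v (F.wordMap j y)) ≤
          c₀ / κ * F.width (i ++ J) v := by
      intro y hy
      have h1 := hd y hy
      rw [area_sub_right] at h1
      refine ⟨(F.width_append_le i J v).trans h1.1, h1.2.trans ?_⟩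
      calc _ = c₀ / κ * (κ * F.wordNorm J * F.width i v) := by field_simp
        _ ≤ _ := by
          gcongr
          exact hwid v hv i J
    -- If the map along `j` displaces backwards, the new point precedes the first point of the image
    -- chain; otherwise it follows the last.
    rcases hσ with rfl | rfl
    · refine ⟨fun k => Nat.casesOn k (F.wordMap j (x 0)) fun k => F.wordMap i (x k), ?_, ?_⟩
      · rintro (_ | k) hk
        · exact hX.wordMap_mem j (hxX 0 (Nat.zero_le m))
        · exact hX.wordMap_mem i (hxX k (by omega))
      · rintro (_ | k) hk
        · simpa using hdisp (x 0) (hxX 0 (Nat.zero_le m))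
        · exact hinner k (by omega)
    · refine ⟨fun k => if k ≤ m then F.wordMap i (x k) else F.wordMap j (x m), ?_, ?_⟩
      · intro k hk
        dsimp only
        split_ifs with h
        · exact hX.wordMap_mem i (hxX k h)
        · exact hX.wordMap_mem j (hxX m le_rfl)
      · intro k hk
        rcases Nat.lt_succ_iff_lt_or_eq.1 hk with h | rfl
        · simpa [h.le, Nat.succ_le_of_lt h] using hinner k h
        · simpa using hdisp (x k) (hxX k le_rfl)

end PlanarAffineIFS

end

/-! ### Flattening a chain by a long cylinder -/

open PlanarAffineIFS in
theorem theorem3p5 {N : ℕ} (F : PlanarAffineIFS N) (X : Set Plane)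
    (hX : F.IsSelfAffineSet X)
    (hdom : F.IsDominated)
    (hsep : F.StrongSeparation X)
    (hposc : ¬ F.ProjectiveOpenSetCondition X)
    (hXF : ¬ ∃ V, F.furstenbergDirections = {V}) :
    1 ≤ assouadDim X := by
  obtain ⟨c, hc, hchain⟩ := exists_chain hX hdom hsep hposc hXF
  obtain ⟨κ, hκ, hexp⟩ := hdom.exists_le_norm_symm_apply
  obtain ⟨C, ρ, hC, hρ, hpow⟩ := hdom.exists_pow_le
  -- Only the existence of a Furstenberg vector is needed here, so any positive `η` serves.
  obtain ⟨v₀, hv₀, -⟩ := exists_abs_area_le_of_not_projectiveOpenSetCondition hX hposc one_pos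
  obtain ⟨l⟩ : Nonempty (Fin N) := by
    obtain ⟨x, hx⟩ := hX.1
    rw [hX.2.2] at hx
    exact ⟨(Set.mem_iUnion.1 hx).choose⟩
  have hbd := hX.2.1.isBounded
  refine one_le_assouadDim (b := c / κ + 1) (by linarith [div_pos hc hκ]) fun m => ?_
  -- `J` does not depend on the direction. Hence `w` can be chosen from `J` first, and the chain
  -- afterwards in the direction pulled back by `w`.
  obtain ⟨J, hJ⟩ := hchain m
  have hJp := F.wordNorm_pos J
  obtain ⟨n, hn⟩ := pow_unbounded_of_one_lt (C * Metric.diam X / (κ ^ 3 * F.wordNorm J)) hρ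
  set w := List.replicate n l with hw
  have hdil : Metric.diam X ≤ κ ^ 3 * F.wordNorm J * dilatation (F.wordLinear w) := by
    have h1 := hpow w
    rw [hw, List.length_replicate, ← hw] at h1
    have h2 := hn.le.trans h1
    rw [div_le_iff₀ (by positivity)] at h2
    refine le_of_mul_le_mul_left ?_ hC
    linarith
  set B := F.wordLinear w
  set v := B.symm v₀ with hv
  have hvS : v ∈ F.furstenbergVectors := F.symm_mem_furstenbergVectors hv₀ w
  obtain ⟨x, hxX, hx⟩ := hJ v hvS
  have hδ : 0 < |planeDet B| := abs_pos.2 (planeDet_ne_zero B)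
  have hv₀p : 0 < ‖v₀‖ := norm_pos_iff.2 hv₀.1
  have hvp : 0 < ‖v‖ := norm_pos_iff.2 hvS.1
  set D := F.width J v with hD
  have hDp : 0 < D := F.width_pos J hvS.1
  have hBv : B v = v₀ := B.apply_symm_apply v₀
  have hvlow : κ * (‖(B.symm : Plane →L[ℝ] Plane)‖ * ‖v₀‖) ≤ ‖v‖ := hexp v₀ hv₀ w
  have hDlow : κ * F.wordNorm J * ‖v‖ ≤ D := by
    have h1 := hexp v hvS J
    rw [hD, width, wordNorm, opNorm_eq_abs_planeDet_mul]
    calc _ = |planeDet (F.wordLinear J)| *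
          (κ * (‖((F.wordLinear J).symm : Plane →L[ℝ] Plane)‖ * ‖v‖)) := by ring
      _ ≤ _ := by gcongr
  -- Of the three factors `κ`, one comes from `hDlow` and two from the square of `hvlow`.
  have hdiam : Metric.diam X * ‖v₀‖ ^ 2 ≤ |planeDet B| * D * ‖v‖ := by
    have hpos := opNorm_pos B.symm
    calc Metric.diam X * ‖v₀‖ ^ 2
        ≤ κ ^ 3 * F.wordNorm J * dilatation B * ‖v₀‖ ^ 2 := by gcongr
      _ = |planeDet B| * (κ * F.wordNorm J *
          (κ * (‖(B.symm : Plane →L[ℝ] Plane)‖ * ‖v₀‖)) ^ 2) := by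
        rw [dilatation, opNorm_eq_abs_planeDet_mul]; ring
      _ ≤ |planeDet B| * (κ * F.wordNorm J * ‖v‖ ^ 2) := by gcongr
      _ = |planeDet B| * (κ * F.wordNorm J * ‖v‖) * ‖v‖ := by ring
      _ ≤ _ := by gcongr
  -- The map `B` multiplies area by its determinant and sends `v` to `v₀`, so a transversal gap `D`
  -- becomes a distance at least `G`.
  set G := |planeDet B| * D / ‖v₀‖ with hG
  have hGp : 0 < G := by positivity
  have hgap : ∀ k l, k ≤ l → l ≤ m →
      ((l : ℝ) - k) * D ≤ area v (x l - x k) ∧ area v (x l - x k) ≤ ((l : ℝ) - k) * (c * D) := by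
    intro k l hkl hl
    rw [area_sub_right]
    exact sub_bounds_of_succ_sub_bounds (f := fun k => area v (x k)) hx hkl hl
  have hlow : ∀ k l, k < l → l ≤ m → G ≤ dist (F.wordMap w (x l)) (F.wordMap w (x k)) := by
    intro k l hkl hl
    rw [dist_eq_norm, wordMap_sub, hG, div_le_iff₀' hv₀p]
    have h1 := abs_area_le v₀ (B (x l - x k))
    rw [area_apply_right, abs_mul] at h1
    refine le_trans ?_ h1
    gcongr
    refine le_trans ?_ (le_abs_self _)
    refine le_trans ?_ (hgap k l hkl.le hl).1
    have : (k : ℝ) + 1 ≤ l := by exact_mod_cast hkl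
    nlinarith
  refine ⟨G, hGp, fun k => F.wordMap w (x k), fun k hk => hX.wordMap_mem w (hxX k hk), ?_, ?_⟩
  · intro k hk l hl hkl
    rcases lt_or_gt_of_ne hkl with h | h
    · rw [dist_comm]; exact hlow k l h hl
    · exact hlow l k h hk
  · intro k hk
    rw [dist_eq_norm, wordMap_sub]
    change ‖B (x k - x 0)‖ ≤ _
    set z := x k - x 0
    have hz : ‖z‖ ≤ Metric.diam X := by
      rw [← dist_eq_norm]
      exact Metric.dist_le_diam_of_mem hbd (hxX k hk) (hxX 0 (Nat.zero_le m))
    have hkm : (k : ℝ) ≤ m := by exact_mod_cast hk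
    have harea : |area v z| ≤ m * (c * D) := by
      have h1 := hgap 0 k (Nat.zero_le k) hk
      rw [Nat.cast_zero, sub_zero] at h1
      rw [abs_of_nonneg (le_trans (by positivity) h1.1)]
      exact h1.2.trans (by gcongr)
    -- Split `z` along `v` and its quarter turn. The first component contributes at most `G` because
    -- `B` is eccentric enough; the second at most `c / κ * m * G` by the upper bound on the gaps.
    have h1 : ‖v‖ ^ 2 * ‖B z‖ ≤ (‖v‖ * Metric.diam X) * ‖v₀‖ +
        m * (c * D) * (‖(B : Plane →L[ℝ] Plane)‖ * ‖v‖) := by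
      have h2 := congrArg B (norm_sq_smul_eq z v)
      rw [map_add, map_smul, map_smul, map_smul, hBv] at h2
      have h3 := congrArg norm h2
      rw [norm_smul, norm_pow, norm_norm] at h3
      rw [h3]
      refine (norm_add_le _ _).trans ?_
      rw [norm_smul, norm_smul, Real.norm_eq_abs, Real.norm_eq_abs]
      gcongr
      · exact (abs_real_inner_le_norm v z).trans (by gcongr)
      · rw [← norm_quarterTurn v]
        exact le_opNorm_apply B _
    have h4 : (‖v‖ * Metric.diam X) * ‖v₀‖ ≤ ‖v‖ ^ 2 * G := by
      rw [hG, mul_div_assoc', le_div_iff₀ hv₀p]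
      calc _ = ‖v‖ * (Metric.diam X * ‖v₀‖ ^ 2) := by ring
        _ ≤ ‖v‖ * (|planeDet B| * D * ‖v‖) := by gcongr
        _ = _ := by ring
    have h5 : m * (c * D) * (‖(B : Plane →L[ℝ] Plane)‖ * ‖v‖) ≤ ‖v‖ ^ 2 * (c / κ * m * G) := by
      have h6 : κ * ‖v₀‖ * ‖(B : Plane →L[ℝ] Plane)‖ ≤ |planeDet B| * ‖v‖ := by
        rw [opNorm_eq_abs_planeDet_mul]
        calc _ = |planeDet B| * (κ * (‖(B.symm : Plane →L[ℝ] Plane)‖ * ‖v₀‖)) := by ring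
          _ ≤ _ := by gcongr
      have h7 : ‖v‖ ^ 2 * (c / κ * m * G) =
          m * (c * D) * ‖v‖ * (|planeDet B| * ‖v‖) / (κ * ‖v₀‖) := by
        rw [hG]; field_simp
      rw [h7, le_div_iff₀ (by positivity)]
      calc _ = m * (c * D) * ‖v‖ * (κ * ‖v₀‖ * ‖(B : Plane →L[ℝ] Plane)‖) := by ring
        _ ≤ _ := by gcongr
    have h8 : ‖B z‖ ≤ G + c / κ * m * G := by
      refine le_of_mul_le_mul_left ?_ (show 0 < ‖v‖ ^ 2 by positivity)
      linarith
    refine h8.trans ?_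
    have h9 : 0 < c / κ := by positivity
    have hm0 : (0 : ℝ) ≤ m := Nat.cast_nonneg m
    have h10 : 0 ≤ c / κ * G + m * G := by positivity
    linarith
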